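/- There is an absolute constant $C>0$ with the following property. Let $d\ge 2$, $\Delta>0$, $L_2\ge 0$, $\sigma_2>0$ and $0<\epsilon<\sigma_1$. Let $F:\mathbb R^d\to\mathbb R$ be $C^2$ with $F(0)-\inf F\le\Delta$ and $\|\nabla^2F(x)-\nabla^2F(y)\|_{\rm op}\le L_2\|x-y\|$ for all $x,y$ (no Lipschitz assumption on $\nabla F$). Let a stochastic second-order oracle for $F$ be given: a query at $x$ draws a fresh $z\sim P_z$ and returns unbiased estimates $\widehat F(x,z)$, $\widehat{\nabla F}(x,z)$, $\widehat{\nabla^2F}(x,z)$ (the last one symmetric) of $F(x),\nabla F(x),\nabla^2F(x)$ with $\mathbb E\|\widehat{\nabla F}(x,z)-\nabla F(x)\|^2\le\sigma_1^2$ and $\mathbb E\|\widehat{\nabla^2F}(x,z)-\nabla^2F(x)\|_{\rm op}^2\le\sigma_2^2$. Consider the subsampled cubic-regularized trust-region method with precision parameter $\bar\epsilon$. Put $M=5\max\{L_2,\bar\epsilon\sigma_2^2\log d/\sigma_1^2\}$, $\eta=25\sqrt{\bar\epsilon/M}$, $T=\lceil 5\Delta/(3\eta\bar\epsilon)\rceil$,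 $n_H=\lceil 22\sigma_2^2\eta^2\log d/\bar\epsilon^2\rceil$, $n=\lceil 5\sigma_1^2/\bar\epsilon^2\rceil$, $b=\min\{1,\eta\sqrt{\sigma_2^2+\bar\epsilon L_2}/(25\sigma_1)\}$, $x^{(0)}=x^{(1)}=0$. In round $t=1,\dots,T$: (i) $H^{(t)}$ is the average of $n_H$ stochastic Hessians at $x^{(t)}$; (ii) a coin with success probability $b$ is tossed. If $t=1$ or the coin succeeds, $g^{(t)}$ is the average of $n$ stochastic gradients at $x^{(t)}$. Otherwise $g^{(t)}=g^{(t-1)}+\sum_{k=1}^{K}\widehat{\nabla^2F}(y_{k-1},z_k)(y_k-y_{k-1})$, where $y_k=\frac kK x^{(t)}+(1-\frac kK)x^{(t-1)}$ and $K=\big\lceil\frac{5(\sigma_2^2+L_2\bar\epsilon)}{b\bar\epsilon^2}\|x^{(t)}-x^{(t-1)}\|^2\big\rceil$; (iii) $x^{(t+1)}$ is a minimizer over $\|y-x^{(t)}\|\le\eta$ of $\langle g^{(t)},y-x^{(t)}\rangle+\frac12\langle y-x^{(t)},H^{(t)}(y-x^{(t)})\rangle+\frac M6\|y-x^{(t)}\|^3$,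 ties being broken by any fixed measurable rule. The method returns $\hat x$ chosen uniformly at random from $x^{(2)},\dots,x^{(T+1)}$. Run this method with $\bar\epsilon=\epsilon/350$. If $$\epsilon\,\sigma_1\le\Delta\big(\sigma_2\sqrt{\log d}+\sqrt{L_2\epsilon}\big),\qquad(*)$$ then with probability at least $\frac34$ it returns a point $\hat x$ with $\|\nabla F(\hat x)\|\le\epsilon$ and makes at most $$C\Big(\frac{\Delta\sigma_1\sigma_2}{\epsilon^3}\sqrt{\log d}+\frac{\Delta L_2^{1/2}\sigma_1}{\epsilon^{5/2}}\Big)$$ stochastic gradient and Hessian queries. Without $(*)$ the same holds with $\sigma_1^2/\epsilon^2$ added inside the brackets. -/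

import Mathlib

open MeasureTheory ProbabilityTheory

noncomputable section

namespace CubicRVR

/-- The domain `ℝᵈ` with its Euclidean norm. -/
abbrev Pt (d : ℕ) : Type := EuclideanSpace ℝ (Fin d)

/-- `d × d` real matrices, as linear operators on `ℝᵈ` with the operator norm. -/
abbrev Op (d : ℕ) : Type := Pt d →L[ℝ] Pt d

/-! ### Functions and oracles -/

/-- The Hessian of `F` at `x`, as a linear operator: the derivative of the gradient. -/
def hessian {d : ℕ} (F : Pt d → ℝ) (x : Pt d) : Op d := fderiv ℝ (gradient F) x

/-- The class of `C²` functions `F : ℝᵈ → ℝ` with `F 0 - inf F ≤ Δ` and `L₂`-Lipschitz Hessian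
(operator norm). Nothing is assumed about the Lipschitz constant of the gradient. -/
structure InFunctionClass {d : ℕ} (Δ L₂ : ℝ) (F : Pt d → ℝ) : Prop where
  contDiff : ContDiff ℝ 2 F
  bddBelow : BddBelow (Set.range F)
  gap : F 0 - (⨅ x, F x) ≤ Δ
  hessian_lipschitz : ∀ x y, ‖hessian F x - hessian F y‖ ≤ L₂ * ‖x - y‖

/-- A stochastic second-order oracle on `ℝᵈ`: a probability law on a measurable space `Z`, and
an answer `(value x z, grad x z, hess x z)` to a query at `x` when the drawn sample is `z`. -/
structure Oracle (d : ℕ) (Z : Type*) [MeasurableSpace Z] where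
  law : Measure Z
  isProbabilityMeasure_law : IsProbabilityMeasure law
  value : Pt d → Z → ℝ
  grad : Pt d → Z → Pt d
  hess : Pt d → Z → Op d
  measurable_value : Measurable (Function.uncurry value)
  measurable_grad : Measurable (Function.uncurry grad)
  measurable_hess : Measurable (Function.uncurry hess)

attribute [instance] Oracle.isProbabilityMeasure_law

/-- The oracle class: unbiased estimators of the value, gradient and Hessian of `F`,
symmetric Hessian estimates, and variance at most `σ₁²` (gradient) and `σ₂²` (Hessian,
operator norm). The variance of the value estimate is unrestricted. -/
structure InOracleClass {d : ℕ} {Z : Type*} [MeasurableSpace Z] (F : Pt d → ℝ) (σ₁ σ₂ : ℝ)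
    (O : Oracle d Z) : Prop where
  integrable_value : ∀ x, Integrable (O.value x) O.law
  mean_value : ∀ x, ∫ z, O.value x z ∂O.law = F x
  integrable_grad : ∀ x, Integrable (O.grad x) O.law
  mean_grad : ∀ x, ∫ z, O.grad x z ∂O.law = gradient F x
  integrable_hess : ∀ x, Integrable (O.hess x) O.law
  mean_hess : ∀ x, ∫ z, O.hess x z ∂O.law = hessian F x
  symm_hess : ∀ x z (u v : Pt d), inner ℝ (O.hess x z u) v = inner ℝ u (O.hess x z v)
  integrable_var_grad : ∀ x, Integrable (fun z => ‖O.grad x z - gradient F x‖ ^ 2) O.law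
  var_grad : ∀ x, ∫ z, ‖O.grad x z - gradient F x‖ ^ 2 ∂O.law ≤ σ₁ ^ 2
  integrable_var_hess : ∀ x, Integrable (fun z => ‖O.hess x z - hessian F x‖ ^ 2) O.law
  var_hess : ∀ x, ∫ z, ‖O.hess x z - hessian F x‖ ^ 2 ∂O.law ≤ σ₂ ^ 2

/-! ### Parameters of the algorithm -/

/-- The inputs of the algorithm: dimension, initial gap `Δ`, Lipschitz constant `L₂` of the
Hessian, variance parameters `σ₁, σ₂`, and the precision parameter `ε`. -/
structure Params where
  d : ℕ
  Δ : ℝ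
  L₂ : ℝ
  σ₁ : ℝ
  σ₂ : ℝ
  ε : ℝ

namespace Params

variable (p : Params)

/-- Cubic regularization parameter `M = 5 max{L₂, ε σ₂² log d / σ₁²}`. -/
def M : ℝ := 5 * max p.L₂ (p.ε * p.σ₂ ^ 2 * Real.log p.d / p.σ₁ ^ 2)

/-- Trust-region radius `η = 25 √(ε / M)`. -/
def η : ℝ := 25 * √(p.ε / p.M)

/-- Number of iterations `T = ⌈5 Δ / (3 η ε)⌉`. -/
def T : ℕ := ⌈5 * p.Δ / (3 * p.η * p.ε)⌉₊

/-- Hessian batch size `n_H = ⌈22 σ₂² η² log d / ε²⌉`. -/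
def nH : ℕ := ⌈22 * p.σ₂ ^ 2 * p.η ^ 2 * Real.log p.d / p.ε ^ 2⌉₊

/-- Reset probability `b = min{1, η √(σ₂² + ε L₂) / (25 σ₁)}`. -/
def b : ℝ := min 1 (p.η * √(p.σ₂ ^ 2 + p.ε * p.L₂) / (25 * p.σ₁))

/-- Gradient batch size `n = ⌈5 σ₁² / ε²⌉`. -/
def n : ℕ := ⌈5 * p.σ₁ ^ 2 / p.ε ^ 2⌉₊

/-- Number `K = ⌈5 (σ₂² + L₂ ε) / (b ε²) · ‖x - xprev‖²⌉` of Hessian-vector products. -/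
def K (x xprev : Pt p.d) : ℕ :=
  ⌈5 * (p.σ₂ ^ 2 + p.L₂ * p.ε) / (p.b * p.ε ^ 2) * ‖x - xprev‖ ^ 2⌉₊

end Params

/-! ### The algorithm -/

section Algorithm

variable (p : Params) {Z : Type*} [MeasurableSpace Z] (O : Oracle p.d Z)

/-- The gradient estimator HVP-RVR. `coin` is the reset coin and `z` the stream of fresh oracle
samples for this call; `gprev = none` encodes `⊥`. It returns the estimate and the number of
oracle queries made, one for each sample used. -/
def hvpRVR (coin : Bool) (z : ℕ → Z) (x xprev : Pt p.d) (gprev : Option (Pt p.d)) :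
    Pt p.d × ℕ :=
  match coin, gprev with
  | false, some g =>
    let K := p.K x xprev
    let pt : ℕ → Pt p.d := fun k => ((k : ℝ) / K) • x + (1 - (k : ℝ) / K) • xprev
    (g + ∑ k ∈ Finset.range K, O.hess (pt k) (z k) (pt (k + 1) - pt k), K)
  | _, _ => ((p.n : ℝ)⁻¹ • ∑ j ∈ Finset.range p.n, O.grad x (z j), p.n)

/-- The empirical Hessian at `x` from the first `n_H` samples of `z`. -/
def hessianEstimate (z : ℕ → Z) (x : Pt p.d) : Op p.d :=
  (p.nH : ℝ)⁻¹ • ∑ j ∈ Finset.range p.nH, O.hess x (z j)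

/-- The cubic model `⟨g, y - x⟩ + ½ ⟨y - x, H (y - x)⟩ + (M / 6) ‖y - x‖³`. -/
def cubicModel (x g : Pt p.d) (H : Op p.d) (y : Pt p.d) : ℝ :=
  inner ℝ g (y - x) + (1 / 2) * inner ℝ (y - x) (H (y - x)) + p.M / 6 * ‖y - x‖ ^ 3

/-- A rule `solve t x g H` for the minimization step of round `t`: in every round and for all
inputs it returns some minimizer of the cubic model over the ball of radius `η` around `x`, and
it is measurable in its inputs. How ties are broken is left open. -/
structure IsCubicSolver (solve : ℕ → Pt p.d → Pt p.d → Op p.d → Pt p.d) : Prop where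
  measurable : ∀ t, Measurable fun q : Pt p.d × Pt p.d × Op p.d => solve t q.1 q.2.1 q.2.2
  mem_ball : ∀ t x g H, ‖solve t x g H - x‖ ≤ p.η
  isMin : ∀ t x g H y, ‖y - x‖ ≤ p.η →
    cubicModel p x g H (solve t x g H) ≤ cubicModel p x g H y

/-- The randomness available to one round: a reset coin, oracle samples for the Hessian estimate
and (separate) oracle samples for the gradient estimate. -/
abbrev RoundSeed (Z : Type*) : Type _ := Bool × (ℕ → Z) × (ℕ → Z)

/-- The state between two rounds. -/
structure State (d : ℕ) where
  x : Pt d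
  xprev : Pt d
  g : Option (Pt d)
  queries : ℕ

variable (solve : ℕ → Pt p.d → Pt p.d → Op p.d → Pt p.d)

/-- Round `t` of the algorithm. -/
def step (t : ℕ) (r : RoundSeed Z) (s : State p.d) : State p.d :=
  let H := hessianEstimate p O r.2.1 s.x
  let e := hvpRVR p O r.1 r.2.2 s.x s.xprev s.g
  { x := solve t s.x e.1 H
    xprev := s.x
    g := some e.1
    queries := s.queries + p.nH + e.2 }

/-- The state after `t` rounds; `r t` is the seed of round `t + 1`. The field `x` of the state
after `t` rounds is the iterate `x⁽ᵗ⁺¹⁾`, and initially `x⁽⁰⁾ = x⁽¹⁾ = 0`, `g⁽⁰⁾ = ⊥`. -/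
def stateAfter (r : ℕ → RoundSeed Z) : ℕ → State p.d
  | 0 => { x := 0, xprev := 0, g := none, queries := 0 }
  | t + 1 => step p O solve (t + 1) (r t) (stateAfter r t)

/-- All the randomness of a run: the seeds of the rounds, and the index of the iterate that is
returned. -/
abbrev Seed (Z : Type*) : Type _ := (ℕ → RoundSeed Z) × ℕ

/-- The law of the randomness of a run: all coins, oracle samples and the output index are
independent, the coins are `Bernoulli(b)`, the samples follow the oracle's law, and the index is
uniform on `{2, …, T + 1}`. -/
def seedLaw : Measure (Seed Z) :=
  (Measure.infinitePi fun _ : ℕ =>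
    (bernoulliMeasure true false (Set.projIcc (0 : ℝ) 1 zero_le_one p.b)).prod
      ((Measure.infinitePi fun _ : ℕ => O.law).prod (Measure.infinitePi fun _ : ℕ => O.law))).prod
    (uniformOn (Set.Icc 2 (p.T + 1)))

/-- The returned point: the iterate `x⁽ⁱ⁾`, where `i` is the random index. -/
def output (ω : Seed Z) : Pt p.d := (stateAfter p O solve ω.1 (ω.2 - 1)).x

/-- The number of oracle queries made in the whole run. -/
def totalQueries (ω : Seed Z) : ℕ := (stateAfter p O solve ω.1 p.T).queries

end Algorithm

/-- The complexity `Δ σ₁ σ₂ √(log d) / ε³ + Δ √L₂ σ₁ / ε^{5/2}`. -/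
def complexity (d : ℕ) (Δ L₂ σ₁ σ₂ ε : ℝ) : ℝ :=
  Δ * σ₁ * σ₂ * √(Real.log d) / ε ^ 3 + Δ * √L₂ * σ₁ / ε ^ (5 / 2 : ℝ)

end CubicRVR

end

/-! Write `ε` for the precision parameter of the run (the target accuracy divided by 350), and `u`,
`w` for the errors of the gradient and Hessian estimates in one round. The argument needs only
second moments of `u` and `w`, a deterministic analysis of one cubic step, and two uses of
averaging.

Deterministic part. Since `M η² = 625 ε`, a step that ends at a point with gradient above `350 ε`
either has length at least `4/5 η` or suffers `u + w η ≥ 100 ε`: at a shorter interior minimizer the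
first order condition of the model forces a small gradient (`InFunctionClass.norm_gradient_le`). A
long step lowers `F` by an amount of order `ε η`, up to `u η + w η² / 2`
(`InFunctionClass.descent`). Both alternatives are merged in `one_le_of_large_gradient`. The
decrease of `F` telescopes to at most `Δ`, and `T` is so large that this pays for only a small
fraction of the rounds.

Stochastic part. The empirical Hessian is a sum of independent centred symmetric matrices. The
squared operator norm is dominated by a squared Schatten norm of exponent `2 ⌈log d⌉`, which is
smooth with constant of order `log d`; it grows by at most that constant times the variance per
summand (`lintegral_opNorm_sum_sq_le`). For the gradient, a Hessian-vector path sum adds a small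
bias and variance to the old error, while a reset, of probability `b`, forgets it. The resulting
recursion contracts by `1 - b/2` and has `ε²` as a fixed point (`lintegral_gradError_le`). Fresh
samples are separated from the past by `lintegral_stream_split`. Expectations are lower integrals,
so integrability along the run is never an issue.

Conclusion. The expected number of iterates with large gradient is at most `T / 10`, so a uniformly
chosen one is bad with probability at most `1/10`. The query count is dominated by a function of the
coins, and Markov's inequality bounds it by ten times the mean of that function, again outside
probability `1/10`. What remains is algebra (`Params.Admissible.meanQueries_le`): the mean is of the
order of the stated complexity plus `σ₁² / ε²`, and (*) says exactly that the complexity dominates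
the latter term. -/

noncomputable section

namespace CubicRVR

/-! ### Taylor estimates for functions with Lipschitz Hessian -/

namespace InFunctionClass

variable {d : ℕ} {Δ L₂ : ℝ} {F : Pt d → ℝ}

theorem differentiable (hF : InFunctionClass Δ L₂ F) : Differentiable ℝ F :=
  hF.contDiff.differentiable (by norm_num)

theorem contDiff_gradient (hF : InFunctionClass Δ L₂ F) : ContDiff ℝ 1 (gradient F) := by
  have h : ContDiff ℝ 1 (fderiv ℝ F) := hF.contDiff.fderiv_right (by norm_num)
  exact (InnerProductSpace.toDual ℝ (Pt d)).symm.contDiff.comp h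

theorem continuous_gradient (hF : InFunctionClass Δ L₂ F) : Continuous (gradient F) :=
  hF.contDiff_gradient.continuous

theorem continuous_hessian (hF : InFunctionClass Δ L₂ F) : Continuous (hessian F) :=
  hF.contDiff_gradient.continuous_fderiv (by norm_num)

theorem hasFDerivAt_gradient (hF : InFunctionClass Δ L₂ F) (x : Pt d) :
    HasFDerivAt (gradient F) (hessian F x) x :=
  (hF.contDiff_gradient.differentiable (by norm_num) x).hasFDerivAt

theorem hasDerivAt_gradient_line (hF : InFunctionClass Δ L₂ F) (x h : Pt d) (t : ℝ) :
    HasDerivAt (fun s : ℝ => gradient F (x + s • h)) (hessian F (x + t • h) h) t := by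
  have h1 : HasDerivAt (fun s : ℝ => x + s • h) h t := by
    simpa using ((hasDerivAt_id t).smul_const h).const_add x
  exact (hF.hasFDerivAt_gradient _).comp_hasDerivAt t h1

theorem hasDerivAt_line (hF : InFunctionClass Δ L₂ F) (x h : Pt d) (t : ℝ) :
    HasDerivAt (fun s : ℝ => F (x + s • h)) (inner ℝ (gradient F (x + t • h)) h) t := by
  have h1 : HasDerivAt (fun s : ℝ => x + s • h) h t := by
    simpa using ((hasDerivAt_id t).smul_const h).const_add x
  exact ((hF.differentiable (x + t • h)).hasGradientAt.hasFDerivAt.comp_hasDerivAt t h1).congr_deriv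
    (by simp)

/-- The remainder vanishes at `t = 0` and its derivative is a Hessian difference of norm at most `L₂
t ‖h‖²`; comparing derivatives replaces the integral remainder. `le_taylor` repeats the comparison
one order lower. -/
theorem norm_gradient_line_sub_le (hF : InFunctionClass Δ L₂ F) (x h : Pt d) {t : ℝ}
    (ht : t ∈ Set.Icc (0 : ℝ) 1) :
    ‖gradient F (x + t • h) - gradient F x - t • hessian F x h‖ ≤ L₂ * t ^ 2 / 2 * ‖h‖ ^ 2 := by
  have hd : ∀ s : ℝ, HasDerivAt
      (fun s : ℝ => gradient F (x + s • h) - gradient F x - s • hessian F x h)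
      (hessian F (x + s • h) h - hessian F x h) s := fun s =>
    (((hF.hasDerivAt_gradient_line x h s).sub_const _).sub
      ((hasDerivAt_id s).smul_const (hessian F x h))).congr_deriv (by simp)
  have hB : ∀ s : ℝ, HasDerivAt (fun s : ℝ => L₂ * s ^ 2 / 2 * ‖h‖ ^ 2)
      (L₂ * s * ‖h‖ ^ 2) s := fun s => by
    refine (((((hasDerivAt_id s).pow 2).const_mul L₂).div_const 2).mul_const
      (‖h‖ ^ 2)).congr_deriv ?_
    simp only [id, Nat.cast_ofNat, mul_one]; ring
  refine image_norm_le_of_norm_deriv_right_le_deriv_boundary (a := 0) (b := 1)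
    (fun s _ => (hd s).continuousAt.continuousWithinAt) (fun s _ => (hd s).hasDerivWithinAt)
    (by simp) hB (fun s hs => ?_) ht
  calc ‖hessian F (x + s • h) h - hessian F x h‖
      ≤ ‖hessian F (x + s • h) - hessian F x‖ * ‖h‖ :=
        (hessian F (x + s • h) - hessian F x).le_opNorm h
    _ ≤ (L₂ * ‖(x + s • h) - x‖) * ‖h‖ := by
        gcongr
        exact hF.hessian_lipschitz _ _
    _ = L₂ * s * ‖h‖ ^ 2 := by
        rw [add_sub_cancel_left, norm_smul, Real.norm_of_nonneg hs.1]; ring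

theorem norm_gradient_add_sub_le (hF : InFunctionClass Δ L₂ F) (x h : Pt d) :
    ‖gradient F (x + h) - gradient F x - hessian F x h‖ ≤ L₂ / 2 * ‖h‖ ^ 2 := by
  simpa using hF.norm_gradient_line_sub_le x h (t := 1) (by simp)

theorem le_taylor (hF : InFunctionClass Δ L₂ F) (x h : Pt d) :
    F (x + h) ≤ F x + inner ℝ (gradient F x) h + 1 / 2 * inner ℝ h (hessian F x h)
      + L₂ / 6 * ‖h‖ ^ 3 := by
  have hd : ∀ s : ℝ, HasDerivAt
      (fun s : ℝ => F (x + s • h) - F x - s * inner ℝ (gradient F x) h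
        - s ^ 2 / 2 * inner ℝ (hessian F x h) h)
      (inner ℝ (gradient F (x + s • h) - gradient F x - s • hessian F x h) h) s := fun s => by
    refine ((((hF.hasDerivAt_line x h s).sub_const (F x)).sub
      ((hasDerivAt_id s).mul_const (inner ℝ (gradient F x) h))).sub
      ((((hasDerivAt_id s).pow 2).div_const 2).mul_const (inner ℝ (hessian F x h) h))).congr_deriv ?_
    simp [inner_sub_left, inner_smul_left]
  have hB : ∀ s : ℝ, HasDerivAt (fun s : ℝ => L₂ * s ^ 3 / 6 * ‖h‖ ^ 3)
      (L₂ * s ^ 2 / 2 * ‖h‖ ^ 3) s := fun s => by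
    refine (((((hasDerivAt_id s).pow 3).const_mul L₂).div_const 6).mul_const
      (‖h‖ ^ 3)).congr_deriv ?_
    simp only [id, Nat.cast_ofNat, mul_one]; ring
  have key := image_norm_le_of_norm_deriv_right_le_deriv_boundary (a := 0) (b := 1)
    (fun s _ => (hd s).continuousAt.continuousWithinAt) (fun s _ => (hd s).hasDerivWithinAt)
    (by simp) hB (fun s hs => ?_) (Set.right_mem_Icc.2 zero_le_one)
  · have := (le_abs_self _).trans key
    simp only [one_smul, one_pow, one_mul, mul_one] at this
    rw [real_inner_comm h (hessian F x h)] at this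
    linarith
  · calc _ ≤ ‖gradient F (x + s • h) - gradient F x - s • hessian F x h‖ * ‖h‖ :=
        norm_inner_le_norm _ _
      _ ≤ (L₂ * s ^ 2 / 2 * ‖h‖ ^ 2) * ‖h‖ := by
        gcongr
        exact hF.norm_gradient_line_sub_le x h ⟨hs.1, hs.2.le⟩
      _ = _ := by ring

end InFunctionClass

/-! ### The cubic regularized step -/

section CubicStep

variable {p : Params} {x g y : Pt p.d} {H : Op p.d}

theorem cubicModel_add (h : Pt p.d) : cubicModel p x g H (x + h) =
    inner ℝ g h + 1 / 2 * inner ℝ h (H h) + p.M / 6 * ‖h‖ ^ 3 := by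
  simp [cubicModel]

/-- The decrease of the model at a minimizer over a ball. -/
theorem cubicModel_le_of_isMin (hy : ‖y - x‖ ≤ p.η)
    (hmin : ∀ w, ‖w - x‖ ≤ p.η → cubicModel p x g H y ≤ cubicModel p x g H w) :
    cubicModel p x g H y ≤ -(p.M / 12) * ‖y - x‖ ^ 3 := by
  obtain ⟨h, rfl⟩ : ∃ h, y = x + h := ⟨y - x, by abel⟩
  rw [add_sub_cancel_left] at hy ⊢
  set G := inner ℝ g h
  set Q := inner ℝ h (H h)
  set R := p.M * ‖h‖ ^ 3 with hR
  have hval : ∀ t : ℝ, cubicModel p x g H (x + t • h) =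
      t * G + t ^ 2 / 2 * Q + |t| ^ 3 / 6 * R := fun t => by
    rw [cubicModel_add, inner_smul_right, map_smul, inner_smul_left, inner_smul_right, norm_smul,
      Real.norm_eq_abs]
    simp only [conj_trivial]
    ring
  have h1 := hval 1
  simp only [one_smul, abs_one] at h1
  have hle : ∀ t : ℝ, |t| ≤ 1 → cubicModel p x g H (x + h) ≤
      t * G + t ^ 2 / 2 * Q + |t| ^ 3 / 6 * R := fun t ht => by
    rw [← hval t]
    refine hmin _ ?_
    rw [add_sub_cancel_left, norm_smul, Real.norm_eq_abs]
    exact (mul_le_of_le_one_left (norm_nonneg _) ht).trans hy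
  rw [h1] at hle ⊢
  -- Reflection through the centre of the ball keeps the quadratic and cubic parts and flips the
  -- linear one.
  have hneg : G ≤ 0 := by
    have := hle (-1) (by simp)
    simp only [abs_neg, abs_one] at this
    linarith
  -- One-sided slope of the model along the ray at `t = 1`. Only inward points are compared, so the
  -- bound also holds when the ball constraint is active, without a multiplier.
  have hslope : G + Q + R / 2 ≤ 0 := by
    have hs : ∀ s ∈ Set.Ioo (0 : ℝ) 1, G + Q + R / 2 ≤ s * (Q / 2 + R / 2 - s * R / 6) := by
      intro s hs
      have h2 := hle (1 - s) (by rw [abs_le]; constructor <;> linarith [hs.1, hs.2])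
      rw [abs_of_pos (by linarith [hs.2])] at h2
      have h3 : s * (G + Q + R / 2) ≤ s * (s * (Q / 2 + R / 2 - s * R / 6)) := by
        nlinarith [h2]
      exact le_of_mul_le_mul_left h3 hs.1
    have hlim : Filter.Tendsto (fun s : ℝ => s * (Q / 2 + R / 2 - s * R / 6))
        (nhdsWithin 0 (Set.Ioi 0)) (nhds 0) := by
      have : Continuous fun s : ℝ => s * (Q / 2 + R / 2 - s * R / 6) := by fun_prop
      simpa using (this.tendsto 0).mono_left nhdsWithin_le_nhds
    refine ge_of_tendsto hlim ?_
    filter_upwards [Ioo_mem_nhdsGT (zero_lt_one' ℝ)] with s hs' using hs s hs'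
  -- The model value `G + Q/2 + R/6` equals `(G + Q + R/2)/2 + G/2 - R/12`.
  linarith

/-- The first order condition at an interior minimizer of the model. -/
theorem gradient_cubicModel_eq_zero (hH : ∀ u v, inner ℝ (H u) v = inner ℝ u (H v))
    (hy : ‖y - x‖ < p.η)
    (hmin : ∀ w, ‖w - x‖ ≤ p.η → cubicModel p x g H y ≤ cubicModel p x g H w) :
    g + H (y - x) + (p.M / 2 * ‖y - x‖) • (y - x) = 0 := by
  obtain ⟨h, rfl⟩ : ∃ h, y = x + h := ⟨y - x, by abel⟩
  rw [add_sub_cancel_left] at hy ⊢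
  have hd : HasFDerivAt (fun u : Pt p.d => inner ℝ g u + 1 / 2 * inner ℝ u (H u)
      + p.M / 6 * ‖u‖ ^ (3 : ℝ))
      (innerSL ℝ g + (1 / 2 : ℝ) • (innerSL ℝ h ∘L H + innerSL ℝ (H h))
        + (p.M / 6) • ((3 * ‖h‖ ^ ((3 : ℝ) - 2)) • innerSL ℝ h)) h := by
    refine ((innerSL ℝ g).hasFDerivAt.add (HasFDerivAt.const_mul ?_ _)).add
      ((hasFDerivAt_norm_rpow h (by norm_num)).const_mul _)
    refine ((hasFDerivAt_id h).inner ℝ H.hasFDerivAt).congr_fderiv ?_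
    ext v
    simp [real_inner_comm v]
  have hloc : IsLocalMin (fun u : Pt p.d => inner ℝ g u + 1 / 2 * inner ℝ u (H u)
      + p.M / 6 * ‖u‖ ^ (3 : ℝ)) h := by
    have : ∀ᶠ u in nhds h, ‖u‖ < p.η := continuous_norm.continuousAt.eventually_lt_const hy
    filter_upwards [this] with u hu
    have := hmin (x + u) (by simpa using hu.le)
    rw [cubicModel_add, cubicModel_add] at this
    exact_mod_cast this
  have h0 := hloc.hasFDerivAt_eq_zero hd
  refine ext_inner_right ℝ fun v => ?_
  have h1 := congrArg (fun f : Pt p.d →L[ℝ] ℝ => f v) h0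
  have h2 : (3 : ℝ) - 2 = 1 := by norm_num
  simp only [h2, Real.rpow_one, add_apply, smul_apply,
    innerSL_apply_apply, ContinuousLinearMap.comp_apply, zero_apply,
    smul_eq_mul] at h1
  rw [inner_add_left, inner_add_left, inner_smul_left, inner_zero_left, hH]
  rw [hH] at h1
  simp only [conj_trivial]
  linarith

variable {Δ L₂ : ℝ} {F : Pt p.d → ℝ}

/-- Decrease of the objective in a step with inexact derivatives. -/
theorem InFunctionClass.descent (hF : InFunctionClass Δ L₂ F) (hL : 5 * L₂ ≤ p.M)
    (hM0 : 0 ≤ p.M)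
    (hy : ‖y - x‖ ≤ p.η)
    (hmin : ∀ w, ‖w - x‖ ≤ p.η → cubicModel p x g H y ≤ cubicModel p x g H w) :
    p.M / 5 * ‖y - x‖ ^ 3 ≤
      F x - F y + ‖g - gradient F x‖ * p.η + 1 / 2 * ‖H - hessian F x‖ * p.η ^ 2 := by
  have hm := cubicModel_le_of_isMin hy hmin
  obtain ⟨h, rfl⟩ : ∃ h, y = x + h := ⟨y - x, by abel⟩
  rw [cubicModel_add] at hm
  rw [add_sub_cancel_left] at hy hm ⊢
  have ht := hF.le_taylor x h
  have hg : inner ℝ (gradient F x) h - inner ℝ g h ≤ ‖g - gradient F x‖ * p.η := by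
    rw [← inner_sub_left, norm_sub_rev]
    exact (real_inner_le_norm _ _).trans (by gcongr)
  have hh : inner ℝ h (hessian F x h) - inner ℝ h (H h) ≤ ‖H - hessian F x‖ * p.η ^ 2 := by
    rw [← inner_sub_right, ← sub_apply, norm_sub_rev]
    calc _ ≤ ‖h‖ * ‖(hessian F x - H) h‖ := real_inner_le_norm _ _
      _ ≤ ‖h‖ * (‖hessian F x - H‖ * ‖h‖) := by
        gcongr; exact ContinuousLinearMap.le_opNorm _ _
      _ = ‖hessian F x - H‖ * ‖h‖ ^ 2 := by ring
      _ ≤ _ := by gcongr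
  -- The cubic coefficients sum to `-M/12 - M/6 + M/30 = -13 M/60`, which is below `-M/5`.
  have hM : L₂ * ‖h‖ ^ 3 ≤ p.M / 5 * ‖h‖ ^ 3 := by gcongr; linarith
  have : 0 ≤ p.M * ‖h‖ ^ 3 := by positivity
  linarith

/-- The gradient after an interior step with inexact derivatives. -/
theorem InFunctionClass.norm_gradient_le (hF : InFunctionClass Δ L₂ F) (hL : 5 * L₂ ≤ p.M)
    (hM0 : 0 ≤ p.M) (hH : ∀ u v, inner ℝ (H u) v = inner ℝ u (H v)) (hy : ‖y - x‖ < p.η)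
    (hmin : ∀ w, ‖w - x‖ ≤ p.η → cubicModel p x g H y ≤ cubicModel p x g H w) :
    ‖gradient F y‖ ≤
      3 / 5 * p.M * ‖y - x‖ ^ 2 + ‖g - gradient F x‖ + ‖H - hessian F x‖ * p.η := by
  have hz := gradient_cubicModel_eq_zero hH hy hmin
  obtain ⟨h, rfl⟩ : ∃ h, y = x + h := ⟨y - x, by abel⟩
  rw [add_sub_cancel_left] at hy hz ⊢
  have e : gradient F (x + h) = (gradient F (x + h) - gradient F x - hessian F x h)
      - (g - gradient F x) - (H - hessian F x) h - (p.M / 2 * ‖h‖) • h := by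
    have : (H - hessian F x) h = H h - hessian F x h := rfl
    rw [this]
    calc gradient F (x + h)
        = gradient F (x + h) - (g + H h + (p.M / 2 * ‖h‖) • h) := by rw [hz, sub_zero]
      _ = _ := by abel
  rw [e]
  have n1 := hF.norm_gradient_add_sub_le x h
  have n2 : ‖(H - hessian F x) h‖ ≤ ‖H - hessian F x‖ * p.η :=
    (ContinuousLinearMap.le_opNorm _ _).trans (by gcongr)
  have n3 : ‖(p.M / 2 * ‖h‖) • h‖ = p.M / 2 * ‖h‖ ^ 2 := by
    rw [norm_smul, Real.norm_of_nonneg (by positivity)]; ring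
  have n4 := norm_sub_le ((gradient F (x + h) - gradient F x - hessian F x h)
      - (g - gradient F x) - (H - hessian F x) h) ((p.M / 2 * ‖h‖) • h)
  have n5 := norm_sub_le ((gradient F (x + h) - gradient F x - hessian F x h)
      - (g - gradient F x)) ((H - hessian F x) h)
  have n6 := norm_sub_le (gradient F (x + h) - gradient F x - hessian F x h)
      (g - gradient F x)
  -- The factor `3/5` is `1/2` from the regularizer plus `1/10` from the Taylor remainder.
  have : L₂ * ‖h‖ ^ 2 ≤ p.M / 5 * ‖h‖ ^ 2 := by gcongr; linarith
  linarith

end CubicStep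

/-! ### A smooth potential for the operator norm of symmetric operators -/

section Trace

variable {d : ℕ}

/-- The trace, as a continuous linear functional on operators. -/
def traceL (d : ℕ) : Op d →L[ℝ] ℝ :=
  LinearMap.toContinuousLinearMap ((LinearMap.trace ℝ (Pt d)) ∘ₗ ContinuousLinearMap.coeLM ℝ)

theorem traceL_apply (A : Op d) : traceL d A = LinearMap.trace ℝ (Pt d) (A : Pt d →ₗ[ℝ] Pt d) := rfl

theorem traceL_mul_comm (A B : Op d) : traceL d (A * B) = traceL d (B * A) :=
  LinearMap.trace_mul_comm ℝ (A : Pt d →ₗ[ℝ] Pt d) (B : Pt d →ₗ[ℝ] Pt d)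

theorem traceL_eq_sum {ι : Type*} [Fintype ι] (v : OrthonormalBasis ι ℝ (Pt d)) (A : Op d) :
    traceL d A = ∑ i, inner ℝ (v i) (A (v i)) := by
  rw [traceL_apply, LinearMap.trace_eq_sum_inner _ v]; rfl

/-- The space of symmetric operators. -/
def symmetricOp (d : ℕ) : Submodule ℝ (Op d) where
  carrier := {A | ∀ u v, inner ℝ (A u) v = inner ℝ u (A v)}
  add_mem' hA hB u v := by
    simp only [Set.mem_ofPred_eq, add_apply, inner_add_left, inner_add_right] at *
    rw [hA, hB]
  zero_mem' u v := by simp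
  smul_mem' c A hA u v := by
    simp only [Set.mem_ofPred_eq, smul_apply, inner_smul_left, inner_smul_right] at *
    rw [hA]; rfl

theorem exists_eigenbasis {Y : Op d} (hY : Y ∈ symmetricOp d) :
    ∃ (v : OrthonormalBasis (Fin d) ℝ (Pt d)) (l : Fin d → ℝ), ∀ a, Y (v a) = l a • v a := by
  have hs : (Y : Pt d →ₗ[ℝ] Pt d).IsSymmetric := hY
  have hn : Module.finrank ℝ (Pt d) = d := by simp
  exact ⟨hs.eigenvectorBasis hn, hs.eigenvalues hn, fun a => hs.apply_eigenvectorBasis hn a⟩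

section Eigenbasis

variable {Y X : Op d} {v : OrthonormalBasis (Fin d) ℝ (Pt d)} {l : Fin d → ℝ}

theorem pow_apply_eigenbasis (hv : ∀ a, Y (v a) = l a • v a) (n : ℕ) (a : Fin d) :
    (Y ^ n) (v a) = l a ^ n • v a := by
  induction n with
  | zero => simp
  | succ n ih =>
    rw [pow_succ', mul_apply_eq_comp, ih, map_smul, hv, smul_smul, pow_succ]

theorem pow_mem_symmetricOp (hY : Y ∈ symmetricOp d) (n : ℕ) : Y ^ n ∈ symmetricOp d := by
  induction n with
  | zero => intro u w; simp
  | succ n ih =>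
    intro u w
    rw [pow_succ', mul_apply_eq_comp, hY, ih, ← mul_apply_eq_comp,
      ← pow_succ, pow_succ']

theorem traceL_pow_eq_sum (hv : ∀ a, Y (v a) = l a • v a) (n : ℕ) :
    traceL d (Y ^ n) = ∑ a, l a ^ n := by
  rw [traceL_eq_sum v]
  refine Finset.sum_congr rfl fun a _ => ?_
  rw [pow_apply_eigenbasis hv, inner_smul_right, real_inner_self_eq_norm_sq, v.norm_eq_one]
  simp

theorem traceL_pow_mul_eq_sum (hY : Y ∈ symmetricOp d) (hX : X ∈ symmetricOp d)
    (hv : ∀ a, Y (v a) = l a • v a) (i j : ℕ) :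
    traceL d (Y ^ i * X * Y ^ j * X) =
      ∑ a, ∑ b, l a ^ i * l b ^ j * (inner ℝ (X (v a)) (v b)) ^ 2 := by
  rw [traceL_eq_sum v]
  refine Finset.sum_congr rfl fun a _ => ?_
  simp only [mul_apply_eq_comp]
  rw [← pow_mem_symmetricOp hY i, pow_apply_eigenbasis hv, inner_smul_left, ← hX,
    ← v.sum_inner_mul_inner, Finset.mul_sum]
  refine Finset.sum_congr rfl fun b _ => ?_
  rw [← pow_mem_symmetricOp hY j, pow_apply_eigenbasis hv, inner_smul_left,
    real_inner_comm (X (v a)) (v b)]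
  simp only [conj_trivial]
  ring

theorem sum_inner_sq_le (X : Op d) (v : OrthonormalBasis (Fin d) ℝ (Pt d)) (a : Fin d) :
    ∑ b, (inner ℝ (X (v a)) (v b)) ^ 2 ≤ ‖X‖ ^ 2 := by
  have h : ∑ b, (inner ℝ (X (v a)) (v b)) ^ 2 = ‖X (v a)‖ ^ 2 := by
    rw [← real_inner_self_eq_norm_sq, ← v.sum_inner_mul_inner]
    refine Finset.sum_congr rfl fun b _ => ?_
    rw [real_inner_comm (X (v a)) (v b), sq]
  rw [h]
  gcongr
  simpa [v.norm_eq_one] using X.le_opNorm (v a)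

end Eigenbasis

theorem traceL_pow_even_nonneg {Y : Op d} (hY : Y ∈ symmetricOp d) (m : ℕ) :
    0 ≤ traceL d (Y ^ (2 * m)) := by
  obtain ⟨v, l, hv⟩ := exists_eigenbasis hY
  rw [traceL_pow_eq_sum hv]
  exact Finset.sum_nonneg fun a _ => by rw [pow_mul]; positivity

/-- In an eigenbasis of `Y` the trace is a sum of `λₐⁱ λ_bʲ` against the symmetric weights `⟨X vₐ,
v_b⟩²`. Symmetrizing in `a, b` and using the rearrangement inequality for `|λ|` replaces the mixed
powers by pure ones, and each row of weights sums to at most `‖X‖²`. -/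
theorem traceL_pow_mul_le {X Y : Op d} (hY : Y ∈ symmetricOp d) (hX : X ∈ symmetricOp d)
    {i j m : ℕ} (hij : i + j = 2 * m) :
    traceL d (Y ^ i * X * Y ^ j * X) ≤ ‖X‖ ^ 2 * traceL d (Y ^ (2 * m)) := by
  obtain ⟨v, l, hv⟩ := exists_eigenbasis hY
  rw [traceL_pow_mul_eq_sum hY hX hv, traceL_pow_eq_sum hv]
  set q : Fin d → Fin d → ℝ := fun a b => (inner ℝ (X (v a)) (v b)) ^ 2 with hq
  have hsymm : ∀ a b, q a b = q b a := fun a b => by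
    simp only [hq]; rw [hX, real_inner_comm]
  have hq0 : ∀ a b, 0 ≤ q a b := fun a b => sq_nonneg _
  have hswap : ∀ f : Fin d → Fin d → ℝ,
      ∑ a, ∑ b, f a b * q a b = ∑ a, ∑ b, f b a * q a b := fun f => by
    rw [Finset.sum_comm]
    simp_rw [hsymm]
  have hpow : ∀ a, |l a| ^ (i + j) = l a ^ (2 * m) := fun a => by
    rw [hij, pow_mul, sq_abs, ← pow_mul]
  have hpt : ∀ a b, l a ^ i * l b ^ j + l b ^ i * l a ^ j ≤ l a ^ (2 * m) + l b ^ (2 * m) := by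
    intro a b
    have h1 : l a ^ i * l b ^ j ≤ |l a| ^ i * |l b| ^ j := by
      rw [← abs_pow, ← abs_pow, ← abs_mul]; exact le_abs_self _
    have h2 : l b ^ i * l a ^ j ≤ |l b| ^ i * |l a| ^ j := by
      rw [← abs_pow, ← abs_pow, ← abs_mul]; exact le_abs_self _
    rw [← hpow, ← hpow, pow_add, pow_add]
    have h3 : 0 ≤ (|l a| ^ i - |l b| ^ i) * (|l a| ^ j - |l b| ^ j) := by
      rcases le_total |l a| |l b| with h | h
      · exact mul_nonneg_of_nonpos_of_nonpos (sub_nonpos.2 (by gcongr)) (sub_nonpos.2 (by gcongr))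
      · exact mul_nonneg (sub_nonneg.2 (by gcongr)) (sub_nonneg.2 (by gcongr))
    linarith
  have hsum : 2 * ∑ a, ∑ b, l a ^ i * l b ^ j * q a b
      ≤ 2 * ∑ a, l a ^ (2 * m) * ∑ b, q a b := by
    calc 2 * ∑ a, ∑ b, l a ^ i * l b ^ j * q a b
        = ∑ a, ∑ b, (l a ^ i * l b ^ j + l b ^ i * l a ^ j) * q a b := by
          rw [two_mul]
          nth_rw 2 [hswap fun a b => l a ^ i * l b ^ j]
          simp_rw [← Finset.sum_add_distrib, add_mul]
      _ ≤ ∑ a, ∑ b, (l a ^ (2 * m) + l b ^ (2 * m)) * q a b := by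
          exact Finset.sum_le_sum fun a _ => Finset.sum_le_sum fun b _ =>
            mul_le_mul_of_nonneg_right (hpt a b) (hq0 a b)
      _ = 2 * ∑ a, ∑ b, l a ^ (2 * m) * q a b := by
          rw [two_mul (∑ a, ∑ b, l a ^ (2 * m) * q a b)]
          nth_rw 2 [hswap fun a b => l a ^ (2 * m)]
          simp_rw [← Finset.sum_add_distrib, add_mul]
      _ = _ := by simp_rw [Finset.mul_sum]
  have hfin : ∑ a, l a ^ (2 * m) * ∑ b, q a b ≤ ‖X‖ ^ 2 * ∑ a, l a ^ (2 * m) := by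
    rw [Finset.mul_sum]
    refine Finset.sum_le_sum fun a _ => ?_
    rw [mul_comm]
    exact mul_le_mul_of_nonneg_right (sum_inner_sq_le X v a) (by rw [pow_mul]; positivity)
  linarith

/-- Hölder for the eigenvalues against the constant function `1`. The case `k = 1` is separate
because the conjugate exponent would be infinite. -/
theorem traceL_pow_le_rpow {Y : Op d} (hY : Y ∈ symmetricOp d) {k : ℕ} (hk : 1 ≤ k) :
    traceL d (Y ^ (2 * (k - 1))) ≤
      (d : ℝ) ^ (1 / (k : ℝ)) * traceL d (Y ^ (2 * k)) ^ (1 - 1 / (k : ℝ)) := by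
  obtain ⟨v, l, hv⟩ := exists_eigenbasis hY
  rw [traceL_pow_eq_sum hv, traceL_pow_eq_sum hv]
  rcases hk.eq_or_lt with rfl | hk
  · simp
  have hk' : (1 : ℝ) < k := by exact_mod_cast hk
  have hpq : (k : ℝ).HolderConjugate (k / (k - 1)) := Real.HolderConjugate.conjExponent hk'
  have h := Real.inner_le_Lp_mul_Lq_of_nonneg (Finset.univ : Finset (Fin d)) hpq
    (f := fun _ => 1) (g := fun a => l a ^ (2 * (k - 1))) (fun _ _ => zero_le_one)
    (fun a _ => by rw [pow_mul]; positivity)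
  have he : ∀ a, (l a ^ (2 * (k - 1))) ^ ((k : ℝ) / (k - 1)) = l a ^ (2 * k) := fun a => by
    rw [pow_mul, pow_mul, ← Real.rpow_natCast, ← Real.rpow_mul (sq_nonneg _),
      Nat.cast_sub hk.le, Nat.cast_one, mul_div_cancel₀ _ (by linarith), Real.rpow_natCast]
  simp only [he, one_mul, Real.one_rpow, Finset.sum_const, Finset.card_univ, Fintype.card_fin,
    nsmul_eq_mul, mul_one] at h
  convert h using 3
  field_simp

theorem norm_sq_le_rpow {Y : Op d} (hY : Y ∈ symmetricOp d) {k : ℕ} (hk : 1 ≤ k) :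
    ‖Y‖ ^ 2 ≤ traceL d (Y ^ (2 * k)) ^ (1 / (k : ℝ)) := by
  obtain ⟨v, l, hv⟩ := exists_eigenbasis hY
  rw [traceL_pow_eq_sum hv]
  set R := (∑ a, l a ^ (2 * k)) ^ (1 / (k : ℝ)) with hR
  have hpos : ∀ a, 0 ≤ l a ^ (2 * k) := fun a => by rw [pow_mul]; positivity
  have hR0 : 0 ≤ R := Real.rpow_nonneg (Finset.sum_nonneg fun a _ => hpos a) _
  have hl : ∀ a, l a ^ 2 ≤ R := fun a => by
    have h1 : l a ^ 2 = (l a ^ (2 * k)) ^ (1 / (k : ℝ)) := by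
      rw [pow_mul, one_div, Real.pow_rpow_inv_natCast (sq_nonneg _) (by omega)]
    rw [h1, hR]
    exact Real.rpow_le_rpow (hpos a)
      (Finset.single_le_sum (f := fun a => l a ^ (2 * k)) (fun b _ => hpos b)
        (Finset.mem_univ a)) (by positivity)
  have hn : ‖Y‖ ≤ √R := by
    refine ContinuousLinearMap.opNorm_le_bound _ (Real.sqrt_nonneg _) fun x => ?_
    refine (sq_le_sq₀ (norm_nonneg _) (by positivity)).1 ?_
    rw [mul_pow, Real.sq_sqrt hR0, ← v.sum_sq_norm_inner_right x, Finset.mul_sum,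
      ← v.sum_sq_norm_inner_right (Y x)]
    refine Finset.sum_le_sum fun a _ => ?_
    rw [← hY, hv, inner_smul_left, norm_mul, mul_pow]
    gcongr
    simpa using hl a
  calc ‖Y‖ ^ 2 ≤ √R ^ 2 := by gcongr
    _ = R := Real.sq_sqrt hR0

/-- A smooth majorant of the squared operator norm of a symmetric operator: a regularized squared
Schatten norm of exponent `2 k`. -/
def schattenPotential (k : ℕ) (δ : ℝ) (S : Op d) : ℝ :=
  (traceL d (S ^ (2 * k)) + δ) ^ (1 / (k : ℝ))

theorem hasDerivAt_pow_line (A X : Op d) (n : ℕ) (t : ℝ) :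
    HasDerivAt (fun s : ℝ => (A + s • X) ^ n)
      (∑ i ∈ Finset.range n, (A + t • X) ^ (n - 1 - i) * X * (A + t • X) ^ i) t := by
  have h1 : HasDerivAt (fun s : ℝ => A + s • X) X t := by
    simpa using ((hasDerivAt_id t).smul_const X).const_add A
  refine ((hasFDerivAt_pow' (𝕜 := ℝ) n).comp_hasDerivAt t h1).congr_deriv ?_
  simp [Nat.pred_eq_sub_one]

/-- The factors do not commute, but cyclicity of the trace makes all terms of the derivative equal.
This collapse is lost for the second derivative. -/
theorem hasDerivAt_traceL_pow_line (A X : Op d) (n : ℕ) (t : ℝ) :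
    HasDerivAt (fun s : ℝ => traceL d ((A + s • X) ^ n))
      (n * traceL d ((A + t • X) ^ (n - 1) * X)) t := by
  refine ((traceL d).hasFDerivAt.comp_hasDerivAt t (hasDerivAt_pow_line A X n t)).congr_deriv ?_
  rw [map_sum]
  have : ∀ i ∈ Finset.range n, traceL d ((A + t • X) ^ (n - 1 - i) * X * (A + t • X) ^ i) =
      traceL d ((A + t • X) ^ (n - 1) * X) := fun i hi => by
    rw [traceL_mul_comm, ← mul_assoc, ← pow_add]
    congr 3
    have := Finset.mem_range.1 hi
    omega
  rw [Finset.sum_congr rfl this]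
  simp

theorem hasDerivAt_traceL_pow_mul_line (A X : Op d) (n : ℕ) (t : ℝ) :
    HasDerivAt (fun s : ℝ => traceL d ((A + s • X) ^ n * X))
      (∑ i ∈ Finset.range n, traceL d ((A + t • X) ^ (n - 1 - i) * X * (A + t • X) ^ i * X)) t := by
  refine ((traceL d).hasFDerivAt.comp_hasDerivAt t
    ((hasDerivAt_pow_line A X n t).mul_const X)).congr_deriv ?_
  rw [Finset.sum_mul, map_sum]

/-- Taylor's inequality of second order on the unit interval. -/
theorem le_taylor_of_deriv_le {f f' f'' : ℝ → ℝ} {c : ℝ} (hf : ∀ t, HasDerivAt f (f' t) t)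
    (hf' : ∀ t, HasDerivAt f' (f'' t) t) (hc : ∀ t, f'' t ≤ c) :
    f 1 ≤ f 0 + f' 0 + c / 2 := by
  have h1 : ∀ t ∈ Set.Icc (0 : ℝ) 1, f' t ≤ f' 0 + c * t := fun t ht =>
    image_le_of_deriv_right_le_deriv_boundary (a := 0) (b := 1) (B := fun t => f' 0 + c * t)
      (B' := fun _ => c)
      (fun s _ => (hf' s).continuousAt.continuousWithinAt) (fun s _ => (hf' s).hasDerivWithinAt)
      (by simp) (by fun_prop)
      (fun s _ => by simpa using (((hasDerivAt_id s).const_mul c).const_add (f' 0)).hasDerivWithinAt)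
      (fun s _ => hc s) ht
  have h2 := image_le_of_deriv_right_le_deriv_boundary (a := 0) (b := 1)
      (B := fun t => f 0 + (f' 0 * t + c * t ^ 2 / 2)) (B' := fun t => f' 0 + c * t)
      (fun s _ => (hf s).continuousAt.continuousWithinAt) (fun s _ => (hf s).hasDerivWithinAt)
      (by simp) (by fun_prop)
      (fun s _ => (HasDerivAt.congr_deriv ((((hasDerivAt_id s).const_mul (f' 0)).add
        ((((hasDerivAt_id s).pow 2).const_mul c).div_const 2)).const_add (f 0))
        (by simp only [id, Nat.cast_ofNat, mul_one]; ring)).hasDerivWithinAt)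
      (fun s hs => h1 s ⟨hs.1, hs.2.le⟩) (Set.right_mem_Icc.2 zero_le_one)
  simp only [mul_one, one_pow] at h2
  linarith

/-- Second order Taylor along `A + t X`. The linear term disappears on average for centred `X`, so
only the quadratic constant counts. The shift `δ > 0` keeps the real power differentiable where the
trace vanishes. -/
theorem schattenPotential_add_le {A X : Op d} (hA : A ∈ symmetricOp d) (hX : X ∈ symmetricOp d)
    {k : ℕ} (hk : 1 ≤ k) {δ : ℝ} (hδ : 0 < δ) :
    schattenPotential k δ (A + X) ≤ schattenPotential k δ A +
      2 * (traceL d (A ^ (2 * k)) + δ) ^ (1 / (k : ℝ) - 1) * traceL d (A ^ (2 * k - 1) * X) +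
      (2 * k - 1) * (d : ℝ) ^ (1 / (k : ℝ)) * ‖X‖ ^ 2 := by
  have hk0 : (0 : ℝ) < k := by exact_mod_cast hk
  have hk1 : (1 : ℝ) ≤ k := by exact_mod_cast hk
  set r : ℝ := 1 / (k : ℝ) with hr
  have hr1 : r ≤ 1 := by rw [hr, div_le_one hk0]; exact hk1
  have hrk : r * k = 1 := by rw [hr]; field_simp
  set Y : ℝ → Op d := fun t => A + t • X with hYdef
  have hY : ∀ t, Y t ∈ symmetricOp d := fun t =>
    (symmetricOp d).add_mem hA ((symmetricOp d).smul_mem t hX)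
  set g : ℝ → ℝ := fun t => traceL d (Y t ^ (2 * k)) with hg
  set g1 : ℝ → ℝ := fun t => traceL d (Y t ^ (2 * k - 1) * X) with hg1
  set g2 : ℝ → ℝ := fun t => ∑ i ∈ Finset.range (2 * k - 1),
    traceL d (Y t ^ (2 * k - 1 - 1 - i) * X * Y t ^ i * X) with hg2
  have hg0 : ∀ t, 0 ≤ g t := fun t => traceL_pow_even_nonneg (hY t) k
  have hgd : ∀ t, HasDerivAt g (2 * k * g1 t) t := fun t => by
    have := hasDerivAt_traceL_pow_line A X (2 * k) t
    push_cast at this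
    exact this
  have hg1d : ∀ t, HasDerivAt g1 (g2 t) t := fun t => hasDerivAt_traceL_pow_mul_line A X _ t
  have hg2le : ∀ t, g2 t ≤ (2 * k - 1) * (‖X‖ ^ 2 * traceL d (Y t ^ (2 * (k - 1)))) := fun t => by
    have h := Finset.sum_le_card_nsmul (Finset.range (2 * k - 1))
      (fun i => traceL d (Y t ^ (2 * k - 1 - 1 - i) * X * Y t ^ i * X))
      (‖X‖ ^ 2 * traceL d (Y t ^ (2 * (k - 1)))) fun i hi =>
        traceL_pow_mul_le (hY t) hX (by have := Finset.mem_range.1 hi; omega)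
    rw [Finset.card_range, nsmul_eq_mul, Nat.cast_sub (by omega)] at h
    push_cast at h
    exact h
  have hφ : ∀ t, HasDerivAt (fun s => (g s + δ) ^ r) (2 * ((g t + δ) ^ (r - 1) * g1 t)) t :=
    fun t => by
    refine (((hgd t).add_const δ).rpow_const (p := r)
      (Or.inl (by have := hg0 t; positivity))).congr_deriv ?_
    linear_combination (2 * g1 t * (g t + δ) ^ (r - 1)) * hrk
  have hψ : ∀ t, HasDerivAt (fun s => 2 * ((g s + δ) ^ (r - 1) * g1 s))
      (2 * (2 * k * g1 t * (r - 1) * (g t + δ) ^ (r - 1 - 1) * g1 t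
        + (g t + δ) ^ (r - 1) * g2 t)) t := fun t =>
    ((((hgd t).add_const δ).rpow_const (p := r - 1)
      (Or.inl (by have := hg0 t; positivity))).mul (hg1d t)).const_mul 2
  have key := le_taylor_of_deriv_le (c := 2 * ((2 * k - 1) * (d : ℝ) ^ r * ‖X‖ ^ 2)) hφ hψ
    fun t => ?_
  · simp only [hg, hYdef, hg1, one_smul] at key
    have hz : A + (0 : ℝ) • X = A := add_eq_left.2 (zero_smul ℝ X)
    rw [hz] at key
    simp only [schattenPotential, ← hr]
    linarith
  · have hp : 0 < g t + δ := by have := hg0 t; positivity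
    -- Concavity of the outer power `1/k` gives this term a favourable sign.
    have h1 : 2 * k * g1 t * (r - 1) * (g t + δ) ^ (r - 1 - 1) * g1 t ≤ 0 := by
      have : 0 ≤ (1 - r) * (2 * k * (g t + δ) ^ (r - 1 - 1) * g1 t ^ 2) :=
        mul_nonneg (by linarith) (by positivity)
      linarith
    -- The power of the trace supplied by Hölder cancels the factor of the outer derivative, leaving
    -- a bound uniform in `t`.
    have h2 : (g t + δ) ^ (r - 1) * g2 t ≤ (2 * k - 1) * (d : ℝ) ^ r * ‖X‖ ^ 2 := by
      have hT : traceL d (Y t ^ (2 * (k - 1))) ≤ (d : ℝ) ^ r * (g t + δ) ^ (1 - r) :=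
        (traceL_pow_le_rpow (hY t) hk).trans (mul_le_mul_of_nonneg_left
          (Real.rpow_le_rpow (hg0 t) (by linarith) (by linarith)) (by positivity))
      have hone : (g t + δ) ^ (r - 1) * (g t + δ) ^ (1 - r) = 1 := by
        rw [← Real.rpow_add hp]; simp
      have hk2 : (0 : ℝ) ≤ 2 * k - 1 := by linarith
      calc (g t + δ) ^ (r - 1) * g2 t
          ≤ (g t + δ) ^ (r - 1) *
              ((2 * k - 1) * (‖X‖ ^ 2 * ((d : ℝ) ^ r * (g t + δ) ^ (1 - r)))) := by
            gcongr
            exact (hg2le t).trans (by gcongr)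
        _ = (2 * k - 1) * (d : ℝ) ^ r * ‖X‖ ^ 2 *
              ((g t + δ) ^ (r - 1) * (g t + δ) ^ (1 - r)) := by ring
        _ = _ := by rw [hone, mul_one]
    linarith

theorem norm_sq_le_schattenPotential {S : Op d} (hS : S ∈ symmetricOp d) {k : ℕ} (hk : 1 ≤ k)
    {δ : ℝ} (hδ : 0 ≤ δ) : ‖S‖ ^ 2 ≤ schattenPotential k δ S :=
  (norm_sq_le_rpow hS hk).trans
    (Real.rpow_le_rpow (traceL_pow_even_nonneg hS k) (by linarith) (by positivity))

theorem schattenPotential_nonneg {S : Op d} (hS : S ∈ symmetricOp d) {k : ℕ}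
    {δ : ℝ} (hδ : 0 ≤ δ) : 0 ≤ schattenPotential k δ S :=
  Real.rpow_nonneg (add_nonneg (traceL_pow_even_nonneg hS k) hδ) _

theorem continuous_traceL_pow (n : ℕ) : Continuous fun S : Op d => traceL d (S ^ n) :=
  (traceL d).continuous.comp (continuous_pow n)

/-- With `k = ⌈log d⌉` the smoothness constant of the potential is at most `22 log d`. -/
theorem smoothness_constant_le {d : ℕ} (hd : 2 ≤ d) :
    (2 * (⌈Real.log d⌉₊ : ℝ) - 1) * (d : ℝ) ^ (1 / (⌈Real.log d⌉₊ : ℝ)) ≤ 22 * Real.log d := by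
  have hd' : (2 : ℝ) ≤ d := by exact_mod_cast hd
  have hl : 0.69 < Real.log d := by
    have := Real.log_two_gt_d9
    have := Real.log_le_log (by norm_num) hd'
    linarith
  set k := ⌈Real.log d⌉₊
  have hk : Real.log d ≤ k := Nat.le_ceil _
  have hk' : (k : ℝ) < Real.log d + 1 := Nat.ceil_lt_add_one (by linarith)
  -- Since `k ≥ log d`, this power is at most `e`.
  have h1 : (d : ℝ) ^ (1 / (k : ℝ)) ≤ 2.7182818286 := by
    rw [Real.rpow_def_of_pos (by linarith)]
    refine le_trans ?_ Real.exp_one_lt_d9.le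
    rw [Real.exp_le_exp, mul_one_div, div_le_one (by linarith)]
    exact hk
  have h2 : 0 < (d : ℝ) ^ (1 / (k : ℝ)) := Real.rpow_pos_of_pos (by linarith) _
  nlinarith

end Trace

/-! ### Independent streams -/

section Stream

variable {S A : Type*} [MeasurableSpace S] [MeasurableSpace A] (ν : Measure S)
  [IsProbabilityMeasure ν]

/-- Conditioning on the past of a stream of independent samples: a function of the first `t`
samples is independent of the next sample. -/
theorem lintegral_stream_split {Φ : (ℕ → S) → A} (hΦ : Measurable Φ) (t : ℕ)
    (hdep : ∀ r r' : ℕ → S, (∀ i < t, r i = r' i) → Φ r = Φ r') {f : A × S → ENNReal}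
    (hf : Measurable f) :
    ∫⁻ r, f (Φ r, r t) ∂(Measure.infinitePi fun _ : ℕ => ν) =
      ∫⁻ r, ∫⁻ s, f (Φ r, s) ∂ν ∂(Measure.infinitePi fun _ : ℕ => ν) := by
  obtain ⟨s₀⟩ : Nonempty S := nonempty_of_isProbabilityMeasure ν
  set P := Measure.infinitePi fun _ : ℕ => ν
  have hind : iIndepFun (fun (i : ℕ) (ω : ℕ → S) => ω i) P :=
    iIndepFun_infinitePi (P := fun _ : ℕ => ν) (X := fun _ => id) fun _ => measurable_id
  have h1 := hind.indepFun_finset (Finset.range t) {t} (by simp) (fun i => measurable_pi_apply i)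
  -- `Φ` ignores later samples, so it factors through the first `t` coordinates, padded by an
  -- arbitrary `s₀`; independence of coordinate blocks then applies.
  set extend : (Finset.range t → S) → ℕ → S := fun q i =>
    if h : i ∈ Finset.range t then q ⟨i, h⟩ else s₀ with hext
  have hextm : Measurable extend := measurable_pi_lambda _ fun i => by
    by_cases h : i ∈ Finset.range t
    · simpa only [hext, h, dite_true] using measurable_pi_apply _
    · simpa only [hext, h, dite_false] using measurable_const
  have hψ : Measurable fun q : (({t} : Finset ℕ) → S) => q ⟨t, Finset.mem_singleton_self t⟩ :=
    measurable_pi_apply _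
  have h2 := h1.comp (hΦ.comp hextm) hψ
  have h3 : (Φ ∘ extend) ∘ (fun (a : ℕ → S) (i : Finset.range t) => a i) = Φ := by
    funext r
    exact hdep _ _ fun i hi => by simp [hext, hi]
  rw [h3] at h2
  have h4 : IndepFun Φ (fun r : ℕ → S => r t) P := h2
  have h5 := (indepFun_iff_map_prod_eq_prod_map_map hΦ.aemeasurable
    (measurable_pi_apply t).aemeasurable).1 h4
  have h6 : P.map (fun r : ℕ → S => r t) = ν :=
    Measure.infinitePi_map_eval (fun _ : ℕ => ν) t
  rw [h6] at h5
  have : IsProbabilityMeasure (P.map Φ) := Measure.isProbabilityMeasure_map hΦ.aemeasurable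
  calc ∫⁻ r, f (Φ r, r t) ∂P = ∫⁻ q, f q ∂(P.map fun r => (Φ r, r t)) :=
        (lintegral_map hf (hΦ.prodMk (measurable_pi_apply t))).symm
    _ = ∫⁻ a, ∫⁻ s, f (a, s) ∂ν ∂(P.map Φ) := by
        rw [h5, lintegral_prod _ hf.aemeasurable]
    _ = _ := lintegral_map hf.lintegral_prod_right' hΦ

end Stream

/-! ### Growth of smooth potentials under independent centred increments -/

section Potential

variable {E Z : Type*} [NormedAddCommGroup E] [NormedSpace ℝ E] [CompleteSpace E]
  [MeasurableSpace Z] {μ : Measure Z} [IsProbabilityMeasure μ]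

/-- A potential that is smooth on a subspace grows by at most the variance under the addition of
a centered random vector. -/
theorem lintegral_potential_add_le {φ : E → ℝ} {y : E} {ℓ : E →L[ℝ] ℝ} {c v : ℝ} (hc : 0 ≤ c)
    {X : Z → E} (hφ0 : ∀ z, 0 ≤ φ (y + X z)) (hφy : 0 ≤ φ y)
    (hφ : ∀ z, φ (y + X z) ≤ φ y + ℓ (X z) + c * ‖X z‖ ^ 2)
    (hX : Integrable X μ) (hX0 : ∫ z, X z ∂μ = 0) (hX2 : Integrable (fun z => ‖X z‖ ^ 2) μ)
    (hv : ∫ z, ‖X z‖ ^ 2 ∂μ ≤ v) :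
    ∫⁻ z, ENNReal.ofReal (φ (y + X z)) ∂μ ≤ ENNReal.ofReal (φ y) + ENNReal.ofReal (c * v) := by
  have hv0 : 0 ≤ v := (integral_nonneg fun z => sq_nonneg _).trans hv
  have hi1 : Integrable (fun z => φ y + ℓ (X z)) μ :=
    (integrable_const _).add (ℓ.integrable_comp hX)
  have hi : Integrable (fun z => φ y + ℓ (X z) + c * ‖X z‖ ^ 2) μ := hi1.add (hX2.const_mul c)
  calc ∫⁻ z, ENNReal.ofReal (φ (y + X z)) ∂μ
      ≤ ∫⁻ z, ENNReal.ofReal (φ y + ℓ (X z) + c * ‖X z‖ ^ 2) ∂μ :=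
        lintegral_mono fun z => ENNReal.ofReal_le_ofReal (hφ z)
    _ = ENNReal.ofReal (∫ z, (φ y + ℓ (X z) + c * ‖X z‖ ^ 2) ∂μ) :=
        (ofReal_integral_eq_lintegral_ofReal hi
          (Filter.Eventually.of_forall fun z => (hφ0 z).trans (hφ z))).symm
    _ ≤ ENNReal.ofReal (φ y + c * v) := by
        refine ENNReal.ofReal_le_ofReal ?_
        rw [integral_add hi1 (hX2.const_mul c), integral_add (integrable_const _)
          (ℓ.integrable_comp hX), integral_const_mul, ℓ.integral_comp_comm hX, hX0]
        simp only [integral_const, probReal_univ, smul_eq_mul, one_mul, map_zero, add_zero]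
        gcongr
    _ = _ := ENNReal.ofReal_add hφy (mul_nonneg hc hv0)

/-- Each new sample is independent of the partial sum before it, so the one-step bound applies
conditionally and adds `c v`. The subspace `V` is there because the Schatten potential is controlled
on symmetric operators only. -/
theorem lintegral_potential_sum_le [SecondCountableTopology E] [MeasurableSpace E] [BorelSpace E]
    {V : Submodule ℝ E} {φ : E → ℝ} (hφm : Measurable φ)
    (hφ0 : ∀ y ∈ V, 0 ≤ φ y) {c v : ℝ} (hc : 0 ≤ c) {ℓ : E → E →L[ℝ] ℝ}
    (hφ : ∀ y ∈ V, ∀ x ∈ V, φ (y + x) ≤ φ y + ℓ y x + c * ‖x‖ ^ 2)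
    {X : ℕ → Z → E} (hXm : ∀ j, Measurable (X j)) (hXV : ∀ j z, X j z ∈ V)
    (hX : ∀ j, Integrable (X j) μ) (hX0 : ∀ j, ∫ z, X j z ∂μ = 0)
    (hX2 : ∀ j, Integrable (fun z => ‖X j z‖ ^ 2) μ) (hv : ∀ j, ∫ z, ‖X j z‖ ^ 2 ∂μ ≤ v)
    {y : E} (hy : y ∈ V) (m : ℕ) :
    ∫⁻ z, ENNReal.ofReal (φ (y + ∑ j ∈ Finset.range m, X j (z j)))
      ∂(Measure.infinitePi fun _ : ℕ => μ) ≤ ENNReal.ofReal (φ y + m * (c * v)) := by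
  have hv0 : 0 ≤ c * v := mul_nonneg hc ((integral_nonneg fun z => sq_nonneg _).trans (hv 0))
  induction m with
  | zero => simp
  | succ m ih =>
    have hmem : ∀ z : ℕ → Z, y + ∑ j ∈ Finset.range m, X j (z j) ∈ V := fun z =>
      V.add_mem hy (V.sum_mem fun j _ => hXV j _)
    have hΦ : Measurable fun z : ℕ → Z => y + ∑ j ∈ Finset.range m, X j (z j) :=
      (Finset.measurable_sum _ fun j _ => (hXm j).comp (measurable_pi_apply j)).const_add y
    have hsplit := lintegral_stream_split μ hΦ m
      (fun r r' h => by
        congr 1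
        exact Finset.sum_congr rfl fun j hj => by rw [h j (Finset.mem_range.1 hj)])
      (f := fun q => ENNReal.ofReal (φ (q.1 + X m q.2)))
      (hφm.comp (measurable_fst.add ((hXm m).comp measurable_snd))).ennreal_ofReal
    simp only [add_assoc] at hsplit
    simp only [Finset.sum_range_succ]
    rw [hsplit]
    calc _ ≤ ∫⁻ z : ℕ → Z, (ENNReal.ofReal (φ (y + ∑ j ∈ Finset.range m, X j (z j)))
          + ENNReal.ofReal (c * v)) ∂(Measure.infinitePi fun _ : ℕ => μ) := by
          refine lintegral_mono fun z => ?_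
          have := lintegral_potential_add_le (μ := μ) (φ := φ)
            (y := y + ∑ j ∈ Finset.range m, X j (z j)) hc
            (fun w => hφ0 _ (V.add_mem (hmem z) (hXV m w))) (hφ0 _ (hmem z))
            (fun w => hφ _ (hmem z) _ (hXV m w)) (hX m) (hX0 m) (hX2 m) (hv m)
          simpa only [add_assoc] using this
      _ ≤ ENNReal.ofReal (φ y + m * (c * v)) + ENNReal.ofReal (c * v) := by
          rw [lintegral_add_right _ measurable_const]
          simpa using ih
      _ = _ := by
          rw [← ENNReal.ofReal_add (add_nonneg (hφ0 y hy) (by positivity)) hv0]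
          congr 1
          push_cast
          ring

end Potential

/-! ### Second moments of independent sums in Hilbert space and in operator norm -/

section SecondMoment

variable {Z : Type*} [MeasurableSpace Z] {μ : Measure Z} [IsProbabilityMeasure μ]

/-- The second moment of a sum of independent centered random vectors. -/
theorem lintegral_norm_add_sum_sq_le {E : Type*} [NormedAddCommGroup E] [InnerProductSpace ℝ E]
    [CompleteSpace E] [SecondCountableTopology E] [MeasurableSpace E] [BorelSpace E] {v : ℝ}
    {X : ℕ → Z → E} (hXm : ∀ j, Measurable (X j))
    (hX : ∀ j, Integrable (X j) μ) (hX0 : ∀ j, ∫ z, X j z ∂μ = 0)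
    (hX2 : ∀ j, Integrable (fun z => ‖X j z‖ ^ 2) μ) (hv : ∀ j, ∫ z, ‖X j z‖ ^ 2 ∂μ ≤ v)
    (y : E) (m : ℕ) :
    ∫⁻ z, ENNReal.ofReal (‖y + ∑ j ∈ Finset.range m, X j (z j)‖ ^ 2)
      ∂(Measure.infinitePi fun _ : ℕ => μ) ≤ ENNReal.ofReal (‖y‖ ^ 2 + m * v) := by
  have := lintegral_potential_sum_le (μ := μ) (V := (⊤ : Submodule ℝ E))
    (φ := fun y => ‖y‖ ^ 2) (c := 1)
    (ℓ := fun y => (2 : ℝ) • innerSL ℝ y) (by fun_prop) (fun y _ => by positivity) zero_le_one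
    (fun y _ x _ => by
      rw [norm_add_sq_real]; simp) hXm (fun _ _ => Submodule.mem_top) hX hX0 hX2 hv
    (Submodule.mem_top (x := y)) m
  simpa using this

/-- The second moment of the operator norm of a sum of independent centered symmetric random
operators. -/
theorem lintegral_opNorm_sum_sq_le {d : ℕ} (hd : 2 ≤ d) {v : ℝ}
    {X : ℕ → Z → Op d} (hXm : ∀ j, Measurable (X j)) (hXV : ∀ j z, X j z ∈ symmetricOp d)
    (hX : ∀ j, Integrable (X j) μ) (hX0 : ∀ j, ∫ z, X j z ∂μ = 0)
    (hX2 : ∀ j, Integrable (fun z => ‖X j z‖ ^ 2) μ) (hv : ∀ j, ∫ z, ‖X j z‖ ^ 2 ∂μ ≤ v)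
    (m : ℕ) :
    ∫⁻ z, ENNReal.ofReal (‖∑ j ∈ Finset.range m, X j (z j)‖ ^ 2)
      ∂(Measure.infinitePi fun _ : ℕ => μ) ≤ ENNReal.ofReal (m * (22 * Real.log d * v)) := by
  set k := ⌈Real.log d⌉₊ with hkdef
  have hd' : (1 : ℝ) < d := by exact_mod_cast (by omega : 1 < d)
  have hk : 1 ≤ k := Nat.ceil_pos.2 (Real.log_pos hd')
  have hk1 : (1 : ℝ) ≤ k := by exact_mod_cast hk
  have hk0 : (0 : ℝ) < k := by linarith
  set c : ℝ := (2 * (k : ℝ) - 1) * (d : ℝ) ^ (1 / (k : ℝ)) with hcdef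
  have hc : 0 ≤ c := mul_nonneg (by linarith) (by positivity)
  have hv0 : 0 ≤ v := (integral_nonneg fun z => sq_nonneg _).trans (hv 0)
  have hbound : ∀ ε : ℝ, 0 < ε → ∫⁻ z, ENNReal.ofReal (‖∑ j ∈ Finset.range m, X j (z j)‖ ^ 2)
      ∂(Measure.infinitePi fun _ : ℕ => μ) ≤ ENNReal.ofReal (ε + m * (c * v)) := by
    intro ε hε
    -- With this shift the potential of the zero operator is exactly `ε`, which is sent to `0`
    -- afterwards.
    set δ : ℝ := ε ^ k
    have hδ : 0 < δ := by positivity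
    have h := lintegral_potential_sum_le (μ := μ) (V := symmetricOp d)
      (φ := schattenPotential k δ) (c := c)
      (ℓ := fun A => (2 * (traceL d (A ^ (2 * k)) + δ) ^ (1 / (k : ℝ) - 1)) •
        (traceL d ∘L ContinuousLinearMap.compL ℝ (Pt d) (Pt d) (Pt d) (A ^ (2 * k - 1))))
      (((continuous_traceL_pow _).measurable.add_const δ).pow_const _)
      (fun y hy => schattenPotential_nonneg hy hδ.le) hc
      (fun A hA x hx => schattenPotential_add_le hA hx hk hδ)
      hXm hXV hX hX0 hX2 hv (symmetricOp d).zero_mem m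
    simp only [zero_add] at h
    have h0 : schattenPotential k δ (0 : Op d) = ε := by
      rw [schattenPotential, zero_pow (by omega), map_zero, zero_add, one_div,
        Real.pow_rpow_inv_natCast hε.le (by omega)]
    rw [h0] at h
    refine (lintegral_mono fun z => ENNReal.ofReal_le_ofReal ?_).trans h
    exact norm_sq_le_schattenPotential ((symmetricOp d).sum_mem fun j _ => hXV j _) hk hδ.le
  have hlim : Filter.Tendsto (fun ε : ℝ => ENNReal.ofReal (ε + m * (c * v)))
      (nhdsWithin 0 (Set.Ioi 0)) (nhds (ENNReal.ofReal (0 + m * (c * v)))) := by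
    have : Continuous fun ε : ℝ => ENNReal.ofReal (ε + m * (c * v)) :=
      ENNReal.continuous_ofReal.comp (by fun_prop)
    exact (this.tendsto 0).mono_left nhdsWithin_le_nhds
  refine (ge_of_tendsto hlim ?_).trans (ENNReal.ofReal_le_ofReal ?_)
  · filter_upwards [self_mem_nhdsWithin] with ε hε using hbound ε hε
  · rw [zero_add]
    gcongr
    exact smoothness_constant_le hd

end SecondMoment

/-! ### Elementary properties of the parameters -/

/-- The standing assumptions on the parameters. -/
structure Params.Admissible (p : Params) : Prop where
  two_le_d : 2 ≤ p.d
  Δ_pos : 0 < p.Δ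
  L₂_nonneg : 0 ≤ p.L₂
  σ₂_pos : 0 < p.σ₂
  ε_pos : 0 < p.ε
  ε_lt : p.ε < p.σ₁

namespace Params.Admissible

variable {p : Params} (hp : p.Admissible)
include hp

theorem σ₁_pos : 0 < p.σ₁ := hp.ε_pos.trans hp.ε_lt

theorem log_pos : 0 < Real.log p.d :=
  Real.log_pos (by exact_mod_cast (by have := hp.two_le_d; omega : 1 < p.d))

theorem M_pos : 0 < p.M := by
  have := hp.log_pos; have := hp.σ₁_pos; have := hp.σ₂_pos; have := hp.ε_pos
  have : 0 < p.ε * p.σ₂ ^ 2 * Real.log p.d / p.σ₁ ^ 2 := by positivity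
  have := le_max_right p.L₂ (p.ε * p.σ₂ ^ 2 * Real.log p.d / p.σ₁ ^ 2)
  rw [Params.M]
  linarith

omit hp in
theorem L₂_le_M (p : Params) : 5 * p.L₂ ≤ p.M := by
  rw [Params.M]
  gcongr
  exact le_max_left _ _

theorem η_pos : 0 < p.η := by
  have := hp.M_pos; have := hp.ε_pos
  rw [Params.η]
  positivity

/-- The balance behind the radius: a step of length `η` costs a gradient term, and per unit length a
decrease, of order `ε`. -/
theorem M_mul_η_sq : p.M * p.η ^ 2 = 625 * p.ε := by
  have := hp.M_pos; have := hp.ε_pos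
  rw [Params.η, mul_pow, Real.sq_sqrt (by positivity)]
  field_simp
  norm_num

theorem b_pos : 0 < p.b := by
  have := hp.η_pos; have := hp.σ₁_pos; have := hp.σ₂_pos; have := hp.ε_pos; have := hp.L₂_nonneg
  rw [Params.b]
  exact lt_min one_pos (by positivity)

omit hp in
theorem b_le_one (p : Params) : p.b ≤ 1 := min_le_left _ _

theorem nH_pos : 0 < p.nH := by
  have := hp.η_pos; have := hp.σ₂_pos; have := hp.ε_pos; have := hp.log_pos
  exact Nat.ceil_pos.2 (by positivity)

theorem n_pos : 0 < p.n := by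
  have := hp.σ₁_pos; have := hp.ε_pos
  exact Nat.ceil_pos.2 (by positivity)

theorem T_pos : 0 < p.T := by
  have := hp.η_pos; have := hp.ε_pos; have := hp.Δ_pos
  exact Nat.ceil_pos.2 (by positivity)

theorem Δ_le : p.Δ ≤ 3 / 5 * p.T * p.η * p.ε := by
  have := hp.η_pos; have := hp.ε_pos
  have h : 5 * p.Δ / (3 * p.η * p.ε) ≤ p.T := Nat.le_ceil _
  rw [div_le_iff₀ (by positivity)] at h
  linarith

/-- One inequality for two purposes: the `σ₂²` part controls the variance of the path sum, the `L₂
ε` part its discretization bias. -/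
theorem le_K (x xprev : Pt p.d) :
    (p.σ₂ ^ 2 + p.L₂ * p.ε) * ‖x - xprev‖ ^ 2 ≤ p.b * p.ε ^ 2 / 5 * p.K x xprev := by
  have := hp.b_pos; have := hp.ε_pos
  have h : 5 * (p.σ₂ ^ 2 + p.L₂ * p.ε) / (p.b * p.ε ^ 2) * ‖x - xprev‖ ^ 2 ≤ p.K x xprev :=
    Nat.le_ceil _
  calc _ = p.b * p.ε ^ 2 / 5 *
        (5 * (p.σ₂ ^ 2 + p.L₂ * p.ε) / (p.b * p.ε ^ 2) * ‖x - xprev‖ ^ 2) := by field_simp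
    _ ≤ _ := by gcongr

end Params.Admissible

/-! ### Accuracy of the estimators -/

section Estimators

variable {p : Params} {Z : Type*} [MeasurableSpace Z] {O : Oracle p.d Z} {F : Pt p.d → ℝ}

theorem InOracleClass.hess_mem (hO : InOracleClass F p.σ₁ p.σ₂ O) (x : Pt p.d) (z : Z) :
    O.hess x z ∈ symmetricOp p.d := hO.symm_hess x z

/-- The Hessian is the mean of symmetric estimates, and the symmetric operators form a closed
subspace. -/
theorem InOracleClass.hessian_mem (hO : InOracleClass F p.σ₁ p.σ₂ O) (x : Pt p.d) :
    hessian F x ∈ symmetricOp p.d := by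
  rw [← hO.mean_hess x]
  exact (symmetricOp p.d).convex.integral_mem (symmetricOp p.d).closed_of_finiteDimensional
    (Filter.Eventually.of_forall fun z => hO.hess_mem x z) (hO.integrable_hess x)

theorem hessianEstimate_mem (hO : InOracleClass F p.σ₁ p.σ₂ O) (z : ℕ → Z) (x : Pt p.d) :
    hessianEstimate p O z x ∈ symmetricOp p.d :=
  (symmetricOp p.d).smul_mem _ ((symmetricOp p.d).sum_mem fun _ _ => hO.hess_mem _ _)

theorem average_sub {E : Type*} [NormedAddCommGroup E] [NormedSpace ℝ E] {m : ℕ} (hm : 0 < m)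
    (f : ℕ → E) (c : E) : (m : ℝ)⁻¹ • ∑ j ∈ Finset.range m, f j - c =
      (m : ℝ)⁻¹ • ∑ j ∈ Finset.range m, (f j - c) := by
  have : (m : ℝ) ≠ 0 := by exact_mod_cast hm.ne'
  rw [Finset.sum_sub_distrib, smul_sub, Finset.sum_const, Finset.card_range,
    ← Nat.cast_smul_eq_nsmul ℝ, smul_smul, inv_mul_cancel₀ this, one_smul]

theorem lintegral_norm_smul_sq {E Ω : Type*} [NormedAddCommGroup E] [NormedSpace ℝ E]
    [MeasurableSpace Ω] (μ : Measure Ω) (c : ℝ) (f : Ω → E) :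
    ∫⁻ ω, ENNReal.ofReal (‖c • f ω‖ ^ 2) ∂μ =
      ENNReal.ofReal (c ^ 2) * ∫⁻ ω, ENNReal.ofReal (‖f ω‖ ^ 2) ∂μ := by
  rw [← lintegral_const_mul' _ _ ENNReal.ofReal_ne_top]
  simp_rw [← ENNReal.ofReal_mul (sq_nonneg c), norm_smul, mul_pow, Real.norm_eq_abs, sq_abs]

theorem lintegral_hessianEstimate_le (hp : p.Admissible)
    (hO : InOracleClass F p.σ₁ p.σ₂ O) (x : Pt p.d) :
    ∫⁻ z, ENNReal.ofReal (‖hessianEstimate p O z x - hessian F x‖ ^ 2)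
      ∂(Measure.infinitePi fun _ : ℕ => O.law) ≤ ENNReal.ofReal (p.ε ^ 2 / p.η ^ 2) := by
  have hm : Measurable (O.hess x) := O.measurable_hess.comp measurable_prodMk_left
  have h := lintegral_opNorm_sum_sq_le (μ := O.law) hp.two_le_d
    (X := fun _ z => O.hess x z - hessian F x) (fun _ => hm.sub_const _)
    (fun _ z => (symmetricOp p.d).sub_mem (hO.hess_mem x z) (hO.hessian_mem x))
    (fun _ => (hO.integrable_hess x).sub (integrable_const _))
    (fun _ => by
      rw [integral_sub (hO.integrable_hess x) (integrable_const _), hO.mean_hess x]; simp)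
    (fun _ => hO.integrable_var_hess x) (fun _ => hO.var_hess x) p.nH
  have hn : (0 : ℝ) < p.nH := by exact_mod_cast hp.nH_pos
  simp only [hessianEstimate, average_sub hp.nH_pos]
  rw [lintegral_norm_smul_sq]
  refine (mul_le_mul_right h _).trans ?_
  rw [← ENNReal.ofReal_mul (sq_nonneg _)]
  refine ENNReal.ofReal_le_ofReal ?_
  have := hp.η_pos; have := hp.ε_pos
  have hle : 22 * p.σ₂ ^ 2 * p.η ^ 2 * Real.log p.d / p.ε ^ 2 ≤ p.nH := Nat.le_ceil _
  rw [div_le_iff₀ (by positivity)] at hle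
  rw [le_div_iff₀ (by positivity)]
  calc ((p.nH : ℝ)⁻¹) ^ 2 * (p.nH * (22 * Real.log p.d * p.σ₂ ^ 2)) * p.η ^ 2
      = (p.nH : ℝ)⁻¹ * (22 * p.σ₂ ^ 2 * p.η ^ 2 * Real.log p.d) := by field_simp
    _ ≤ (p.nH : ℝ)⁻¹ * (p.nH * p.ε ^ 2) := by gcongr
    _ = p.ε ^ 2 := by field_simp

variable (p O) in
/-- The gradient estimate of a reset round. -/
def gradientEstimate (z : ℕ → Z) (x : Pt p.d) : Pt p.d :=
  (p.n : ℝ)⁻¹ • ∑ j ∈ Finset.range p.n, O.grad x (z j)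

theorem lintegral_gradientEstimate_le (hp : p.Admissible)
    (hO : InOracleClass F p.σ₁ p.σ₂ O) (x : Pt p.d) :
    ∫⁻ z, ENNReal.ofReal (‖gradientEstimate p O z x - gradient F x‖ ^ 2)
      ∂(Measure.infinitePi fun _ : ℕ => O.law) ≤ ENNReal.ofReal (p.ε ^ 2 / 5) := by
  have hm : Measurable (O.grad x) := O.measurable_grad.comp measurable_prodMk_left
  have h := lintegral_norm_add_sum_sq_le (μ := O.law)
    (X := fun _ z => O.grad x z - gradient F x) (fun _ => hm.sub_const _)
    (fun _ => (hO.integrable_grad x).sub (integrable_const _))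
    (fun _ => by
      rw [integral_sub (hO.integrable_grad x) (integrable_const _), hO.mean_grad x]; simp)
    (fun _ => hO.integrable_var_grad x) (fun _ => hO.var_grad x) 0 p.n
  have hn : (0 : ℝ) < p.n := by exact_mod_cast hp.n_pos
  simp only [zero_add, norm_zero, ne_eq, OfNat.ofNat_ne_zero, not_false_eq_true, zero_pow] at h
  simp only [gradientEstimate, average_sub hp.n_pos]
  rw [lintegral_norm_smul_sq]
  refine (mul_le_mul_right h _).trans ?_
  rw [← ENNReal.ofReal_mul (sq_nonneg _)]
  refine ENNReal.ofReal_le_ofReal ?_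
  have := hp.ε_pos
  have hle : 5 * p.σ₁ ^ 2 / p.ε ^ 2 ≤ p.n := Nat.le_ceil _
  rw [div_le_iff₀ (by positivity)] at hle
  calc ((p.n : ℝ)⁻¹) ^ 2 * (p.n * p.σ₁ ^ 2) = (p.n : ℝ)⁻¹ * (p.σ₁ ^ 2) := by field_simp
    _ ≤ (p.n : ℝ)⁻¹ * (p.n * p.ε ^ 2 / 5) := by gcongr; linarith
    _ = p.ε ^ 2 / 5 := by field_simp

variable (p O) in
/-- The sum of Hessian-vector products along the segment from `xprev` to `x` with `N` nodes. -/
def hvpSum (N : ℕ) (z : ℕ → Z) (x xprev : Pt p.d) : Pt p.d :=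
  ∑ k ∈ Finset.range N, O.hess (((k : ℝ) / N) • x + (1 - (k : ℝ) / N) • xprev) (z k)
    (((((k + 1 : ℕ) : ℝ) / N) • x + (1 - ((k + 1 : ℕ) : ℝ) / N) • xprev) -
      (((k : ℝ) / N) • x + (1 - (k : ℝ) / N) • xprev))

variable (O) in
theorem hvpRVR_none (c : Bool) (z : ℕ → Z) (x xprev : Pt p.d) :
    hvpRVR p O c z x xprev none = (gradientEstimate p O z x, p.n) := by
  cases c <;> rfl

variable (O) in
theorem hvpRVR_true (z : ℕ → Z) (x xprev : Pt p.d) (g : Option (Pt p.d)) :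
    hvpRVR p O true z x xprev g = (gradientEstimate p O z x, p.n) := rfl

variable (O) in
theorem hvpRVR_false (z : ℕ → Z) (x xprev g : Pt p.d) :
    hvpRVR p O false z x xprev (some g) =
      (g + hvpSum p O (p.K x xprev) z x xprev, p.K x xprev) := rfl

/-- The nodes are fixed once `x` and `xprev` are. The exact gradient increments telescope; what
remains is a deterministic bias of at most `L₂/2 ‖w‖²` per segment and independent centred noise,
orthogonal to it in mean square. -/
theorem lintegral_hvpSum_le {Δ : ℝ} (hF : InFunctionClass Δ p.L₂ F)
    (hO : InOracleClass F p.σ₁ p.σ₂ O) {N : ℕ} (hN : 0 < N) (x xprev g : Pt p.d) :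
    ∫⁻ z, ENNReal.ofReal (‖g + hvpSum p O N z x xprev - gradient F x‖ ^ 2)
      ∂(Measure.infinitePi fun _ : ℕ => O.law) ≤
      ENNReal.ofReal ((‖g - gradient F xprev‖ + p.L₂ / 2 * ‖x - xprev‖ ^ 2 / N) ^ 2 +
        p.σ₂ ^ 2 * ‖x - xprev‖ ^ 2 / N) := by
  have hN' : (0 : ℝ) < N := by exact_mod_cast hN
  set w : Pt p.d := (N : ℝ)⁻¹ • (x - xprev) with hw
  have hwn : ‖w‖ = ‖x - xprev‖ / N := by
    rw [hw, norm_smul, norm_inv, Real.norm_of_nonneg hN'.le]; ring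
  set pt : ℕ → Pt p.d := fun k => ((k : ℝ) / N) • x + (1 - (k : ℝ) / N) • xprev with hpt
  have hstep : ∀ k, pt (k + 1) = pt k + w := fun k => by
    simp only [hpt, hw]
    push_cast
    module
  have hpt0 : pt 0 = xprev := by simp [hpt]
  have hptN : pt N = x := by simp [hpt, hN'.ne']
  set X : ℕ → Z → Pt p.d := fun k z => O.hess (pt k) z w - hessian F (pt k) w with hX
  set ev : Op p.d →L[ℝ] Pt p.d := ContinuousLinearMap.apply ℝ (Pt p.d) w
  have hev : ∀ A : Op p.d, ev A = A w := fun A => rfl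
  have hint : ∀ k, Integrable (fun z => O.hess (pt k) z w) O.law := fun k =>
    ev.integrable_comp (hO.integrable_hess (pt k))
  have hXm : ∀ k, Measurable (X k) := fun k =>
    (ev.measurable.comp (O.measurable_hess.comp measurable_prodMk_left)).sub_const _
  have hXi : ∀ k, Integrable (X k) O.law := fun k => (hint k).sub (integrable_const _)
  have hX0 : ∀ k, ∫ z, X k z ∂O.law = 0 := fun k => by
    have h1 : ∫ z, O.hess (pt k) z w ∂O.law = hessian F (pt k) w := by
      rw [← hO.mean_hess (pt k)]
      exact ev.integral_comp_comm (hO.integrable_hess (pt k))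
    simp only [hX]
    rw [integral_sub (hint k) (integrable_const _), h1]
    simp
  have hXle : ∀ k z, ‖X k z‖ ^ 2 ≤ ‖O.hess (pt k) z - hessian F (pt k)‖ ^ 2 * ‖w‖ ^ 2 :=
    fun k z => by
    rw [← mul_pow]
    gcongr
    exact (O.hess (pt k) z - hessian F (pt k)).le_opNorm w
  have hX2 : ∀ k, Integrable (fun z => ‖X k z‖ ^ 2) O.law := fun k =>
    ((hO.integrable_var_hess (pt k)).mul_const (‖w‖ ^ 2)).mono'
      ((hXm k).norm.pow_const 2).aestronglyMeasurable
      (Filter.Eventually.of_forall fun z => by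
        rw [Real.norm_of_nonneg (sq_nonneg _)]; exact hXle k z)
  have hv : ∀ k, ∫ z, ‖X k z‖ ^ 2 ∂O.law ≤ p.σ₂ ^ 2 * ‖w‖ ^ 2 := fun k => by
    refine (integral_mono (hX2 k) ((hO.integrable_var_hess (pt k)).mul_const _)
      (hXle k)).trans ?_
    rw [integral_mul_const]
    gcongr
    exact hO.var_hess (pt k)
  set m : Pt p.d := ∑ k ∈ Finset.range N,
    (hessian F (pt k) w - (gradient F (pt (k + 1)) - gradient F (pt k))) with hm
  have hmn : ‖m‖ ≤ p.L₂ / 2 * ‖x - xprev‖ ^ 2 / N := by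
    refine (norm_sum_le_of_le _ (n := fun _ => p.L₂ / 2 * ‖w‖ ^ 2) fun k _ => ?_).trans ?_
    · rw [hstep, norm_sub_rev]
      exact hF.norm_gradient_add_sub_le (pt k) w
    · rw [Finset.sum_const, Finset.card_range, nsmul_eq_mul, hwn]
      apply le_of_eq
      field_simp
  have hdecomp : ∀ z : ℕ → Z, g + hvpSum p O N z x xprev - gradient F x =
      (g - gradient F xprev + m) + ∑ k ∈ Finset.range N, X k (z k) := fun z => by
    have h1 : hvpSum p O N z x xprev = ∑ k ∈ Finset.range N, O.hess (pt k) (z k) w := by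
      refine Finset.sum_congr rfl fun k _ => ?_
      have h2 : pt (k + 1) - pt k = w := by rw [hstep, add_sub_cancel_left]
      exact congrArg (O.hess (pt k) (z k)) h2
    rw [h1, hm, Finset.sum_sub_distrib, Finset.sum_range_sub (fun k => gradient F (pt k)), hptN,
      hpt0]
    simp only [hX, Finset.sum_sub_distrib]
    abel
  simp only [hdecomp]
  refine (lintegral_norm_add_sum_sq_le (μ := O.law) hXm hXi hX0 hX2 hv _ N).trans
    (ENNReal.ofReal_le_ofReal ?_)
  gcongr
  · exact (norm_add_le _ _).trans (by gcongr)
  · rw [hwn]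
    apply le_of_eq
    field_simp

theorem lintegral_hvp_le {Δ : ℝ} (hp : p.Admissible) (hF : InFunctionClass Δ p.L₂ F)
    (hO : InOracleClass F p.σ₁ p.σ₂ O) (x xprev g : Pt p.d) :
    ∫⁻ z, ENNReal.ofReal
        (‖g + hvpSum p O (p.K x xprev) z x xprev - gradient F x‖ ^ 2)
      ∂(Measure.infinitePi fun _ : ℕ => O.law) ≤
      ENNReal.ofReal ((‖g - gradient F xprev‖ + p.b * p.ε / 10) ^ 2 + p.b * p.ε ^ 2 / 5) := by
  have hb := hp.b_pos; have hε := hp.ε_pos; have hL := hp.L₂_nonneg; have hσ := hp.σ₂_pos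
  have hK := hp.le_K x xprev
  rcases (Nat.zero_le (p.K x xprev)).eq_or_lt with h0 | hpos
  · rw [← h0] at hK
    -- No nodes means no displacement, since `σ₂ > 0` makes the coefficient in `K` positive; the old
    -- error is then carried over unchanged.
    have hx : x = xprev := by
      have h1 : 0 < p.σ₂ ^ 2 + p.L₂ * p.ε := by positivity
      have h2 : ‖x - xprev‖ ^ 2 ≤ 0 := by
        simp only [Nat.cast_zero, mul_zero] at hK
        exact nonpos_of_mul_nonpos_right hK h1
      have h3 : ‖x - xprev‖ = 0 := by
        have := sq_nonneg ‖x - xprev‖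
        exact pow_eq_zero_iff (two_ne_zero) |>.1 (le_antisymm h2 this)
      exact sub_eq_zero.1 (norm_eq_zero.1 h3)
    rw [← h0]
    subst hx
    simp only [hvpSum, Finset.range_zero, Finset.sum_empty, add_zero, lintegral_const,
      measure_univ, mul_one]
    refine ENNReal.ofReal_le_ofReal ?_
    have h4 : ‖g - gradient F x‖ ^ 2 ≤ (‖g - gradient F x‖ + p.b * p.ε / 10) ^ 2 := by
      gcongr
      have : 0 ≤ p.b * p.ε / 10 := by positivity
      linarith
    have : 0 ≤ p.b * p.ε ^ 2 / 5 := by positivity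
    linarith
  · refine (lintegral_hvpSum_le hF hO hpos x xprev g).trans (ENNReal.ofReal_le_ofReal ?_)
    have hN : (0 : ℝ) < p.K x xprev := by exact_mod_cast hpos
    have hD : 0 ≤ ‖x - xprev‖ ^ 2 := sq_nonneg _
    gcongr (_ + ?_) ^ 2 + ?_
    · rw [div_le_iff₀ hN]
      have : p.ε * (p.L₂ * ‖x - xprev‖ ^ 2) ≤ p.ε * (p.b * p.ε / 5 * p.K x xprev) := by
        nlinarith [mul_nonneg (sq_nonneg p.σ₂) hD]
      have := le_of_mul_le_mul_left this hε
      linarith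
    · rw [div_le_iff₀ hN]
      nlinarith [mul_nonneg (mul_nonneg hL hε.le) hD]

/-! ### One round -/

/-! ### Measurability of the estimators in samples and points -/

section Measurability

variable (p O)

theorem measurable_gradientEstimate :
    Measurable fun q : (ℕ → Z) × Pt p.d => gradientEstimate p O q.1 q.2 := by
  unfold gradientEstimate
  have h : ∀ j ∈ Finset.range p.n, Measurable fun q : (ℕ → Z) × Pt p.d => O.grad q.2 (q.1 j) :=
    fun j _ => O.measurable_grad.comp
      (measurable_snd.prodMk ((measurable_pi_apply j).comp measurable_fst))
  exact (Finset.measurable_sum _ h).const_smul (p.n : ℝ)⁻¹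

theorem measurable_hessianEstimate :
    Measurable fun q : (ℕ → Z) × Pt p.d => hessianEstimate p O q.1 q.2 := by
  unfold hessianEstimate
  have h : ∀ j ∈ Finset.range p.nH, Measurable fun q : (ℕ → Z) × Pt p.d => O.hess q.2 (q.1 j) :=
    fun j _ => O.measurable_hess.comp
      (measurable_snd.prodMk ((measurable_pi_apply j).comp measurable_fst))
  exact (Finset.measurable_sum _ h).const_smul (p.nH : ℝ)⁻¹

theorem measurable_hvpSum (N : ℕ) :
    Measurable fun q : (ℕ → Z) × Pt p.d × Pt p.d => hvpSum p O N q.1 q.2.1 q.2.2 := by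
  refine Finset.measurable_sum _ fun k _ => ?_
  refine ContinuousLinearMap.measurable_apply₂.comp (Measurable.prodMk
    (O.measurable_hess.comp (Measurable.prodMk ?_ ((measurable_pi_apply k).comp measurable_fst))) ?_)
  · fun_prop
  · fun_prop

theorem measurable_K : Measurable fun q : Pt p.d × Pt p.d => p.K q.1 q.2 := by
  have : Measurable fun q : Pt p.d × Pt p.d =>
      5 * (p.σ₂ ^ 2 + p.L₂ * p.ε) / (p.b * p.ε ^ 2) * ‖q.1 - q.2‖ ^ 2 := by fun_prop
  exact Nat.measurable_ceil.comp this

theorem measurable_hvpRVR_some :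
    Measurable fun q : Bool × (ℕ → Z) × Pt p.d × Pt p.d × Pt p.d =>
      (hvpRVR p O q.1 q.2.1 q.2.2.1 q.2.2.2.1 (some q.2.2.2.2)).1 := by
  refine measurable_from_prod_countable_right fun c => ?_
  cases c with
  | true =>
    simp only [hvpRVR_true]
    exact (measurable_gradientEstimate p O).comp
      (measurable_fst.prodMk (measurable_fst.comp measurable_snd))
  | false =>
    simp only [hvpRVR_false]
    -- The number of nodes depends on the points but is a natural number, so measurability can be
    -- checked with it frozen.
    have h1 : Measurable fun q : ℕ × (ℕ → Z) × Pt p.d × Pt p.d =>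
        hvpSum p O q.1 q.2.1 q.2.2.1 q.2.2.2 :=
      measurable_from_prod_countable_right fun N => measurable_hvpSum p O N
    have h2 : Measurable fun y : (ℕ → Z) × Pt p.d × Pt p.d × Pt p.d =>
        (p.K y.2.1 y.2.2.1, y.1, y.2.1, y.2.2.1) :=
      ((measurable_K p).comp (f := fun y : (ℕ → Z) × Pt p.d × Pt p.d × Pt p.d =>
        (y.2.1, y.2.2.1)) (by fun_prop)).prodMk (by fun_prop)
    have h3 : Measurable fun y : (ℕ → Z) × Pt p.d × Pt p.d × Pt p.d => y.2.2.2 := by fun_prop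
    have h4 : Measurable fun y : (ℕ → Z) × Pt p.d × Pt p.d × Pt p.d =>
        hvpSum p O (p.K y.2.1 y.2.2.1) y.1 y.2.1 y.2.2.1 := by
      simpa only [Function.comp_def] using h1.comp h2
    exact h3.add h4

end Measurability

variable (p O) in
/-- The law of the randomness of one round. -/
def roundLaw : Measure (RoundSeed Z) :=
  (bernoulliMeasure true false (Set.projIcc (0 : ℝ) 1 zero_le_one p.b)).prod
      ((Measure.infinitePi fun _ : ℕ => O.law).prod (Measure.infinitePi fun _ : ℕ => O.law))

instance : IsProbabilityMeasure (roundLaw p O) := by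
  unfold roundLaw; infer_instance

theorem lintegral_roundLaw (hp : p.Admissible) {f : RoundSeed Z → ENNReal} (hf : Measurable f) :
    ∫⁻ r, f r ∂(roundLaw p O) =
      ENNReal.ofReal p.b * ∫⁻ w, f (true, w)
        ∂((Measure.infinitePi fun _ : ℕ => O.law).prod (Measure.infinitePi fun _ : ℕ => O.law)) +
      ENNReal.ofReal (1 - p.b) * ∫⁻ w, f (false, w)
        ∂((Measure.infinitePi fun _ : ℕ => O.law).prod
          (Measure.infinitePi fun _ : ℕ => O.law)) := by
  have hb := hp.b_pos
  have hb1 := Params.Admissible.b_le_one p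
  rw [roundLaw, lintegral_prod _ hf.aemeasurable, bernoulliMeasure_def,
    lintegral_add_measure, lintegral_smul_measure, lintegral_smul_measure, lintegral_dirac,
    lintegral_dirac, Set.projIcc_of_mem zero_le_one ⟨hb.le, hb1⟩]
  congr 1
  · rw [ENNReal.smul_def, smul_eq_mul, ENNReal.ofReal]
    congr 2
    ext
    simp [hb.le]
  · rw [ENNReal.smul_def, smul_eq_mul, ENNReal.ofReal]
    congr 2
    ext
    simp [hb1]

theorem lintegral_roundLaw_hess {f : (ℕ → Z) → ENNReal} (hf : Measurable f) :
    ∫⁻ r, f r.2.1 ∂(roundLaw p O) = ∫⁻ z, f z ∂(Measure.infinitePi fun _ : ℕ => O.law) :=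
  (measurePreserving_fst.comp measurePreserving_snd :
    MeasurePreserving (fun r : RoundSeed Z => r.2.1) (roundLaw p O) _).lintegral_comp hf

theorem lintegral_roundLaw_grad {f : (ℕ → Z) → ENNReal} (hf : Measurable f) :
    ∫⁻ r, f r.2.2 ∂(roundLaw p O) = ∫⁻ z, f z ∂(Measure.infinitePi fun _ : ℕ => O.law) :=
  (measurePreserving_snd.comp measurePreserving_snd :
    MeasurePreserving (fun r : RoundSeed Z => r.2.2) (roundLaw p O) _).lintegral_comp hf

theorem lintegral_prod_grad {f : (ℕ → Z) → ENNReal} (hf : Measurable f) :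
    ∫⁻ w : (ℕ → Z) × (ℕ → Z), f w.2
      ∂((Measure.infinitePi fun _ : ℕ => O.law).prod (Measure.infinitePi fun _ : ℕ => O.law)) =
      ∫⁻ z, f z ∂(Measure.infinitePi fun _ : ℕ => O.law) :=
  measurePreserving_snd.lintegral_comp hf

/-- The recursion for the mean squared error of the gradient estimator. -/
theorem lintegral_hvpRVR_some_le {Δ : ℝ} (hp : p.Admissible) (hF : InFunctionClass Δ p.L₂ F)
    (hO : InOracleClass F p.σ₁ p.σ₂ O) (x xprev g : Pt p.d) :
    ∫⁻ r, ENNReal.ofReal (‖(hvpRVR p O r.1 r.2.2 x xprev (some g)).1 - gradient F x‖ ^ 2)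
      ∂(roundLaw p O) ≤
      ENNReal.ofReal (p.b * p.ε ^ 2 / 2) +
        ENNReal.ofReal (1 - p.b / 2) * ENNReal.ofReal (‖g - gradient F xprev‖ ^ 2) := by
  have hb := hp.b_pos
  have hb1 := Params.Admissible.b_le_one p
  have hε := hp.ε_pos
  have hR : Measurable fun r : RoundSeed Z =>
      (hvpRVR p O r.1 r.2.2 x xprev (some g)).1 :=
    (measurable_hvpRVR_some p O).comp (f := fun r : RoundSeed Z => (r.1, r.2.2, x, xprev, g))
      (by fun_prop)
  rw [lintegral_roundLaw hp ((hR.sub_const _).norm.pow_const 2).ennreal_ofReal]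
  simp only [hvpRVR_true, hvpRVR_false]
  have hG : Measurable fun z : ℕ → Z => gradientEstimate p O z x :=
    (measurable_gradientEstimate p O).comp (f := fun z => (z, x)) (by fun_prop)
  have hH : Measurable fun z : ℕ → Z => hvpSum p O (p.K x xprev) z x xprev :=
    (measurable_hvpSum p O _).comp (f := fun z => (z, x, xprev)) (by fun_prop)
  have hm1 : Measurable fun z : ℕ → Z =>
      ENNReal.ofReal (‖gradientEstimate p O z x - gradient F x‖ ^ 2) :=
    ((hG.sub_const _).norm.pow_const 2).ennreal_ofReal
  have hm2 : Measurable fun z : ℕ → Z =>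
      ENNReal.ofReal (‖g + hvpSum p O (p.K x xprev) z x xprev - gradient F x‖ ^ 2) :=
    (((hH.const_add g).sub_const _).norm.pow_const 2).ennreal_ofReal
  rw [lintegral_prod_grad hm1, lintegral_prod_grad hm2]
  refine (add_le_add (mul_le_mul_right (lintegral_gradientEstimate_le hp hO x) _)
    (mul_le_mul_right (lintegral_hvp_le hp hF hO x xprev g) _)).trans ?_
  set a := ‖g - gradient F xprev‖ with ha
  have ha0 : 0 ≤ a := norm_nonneg _
  have h1b : 0 ≤ 1 - p.b := by linarith
  rw [← ENNReal.ofReal_mul hb.le, ← ENNReal.ofReal_mul h1b,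
    ← ENNReal.ofReal_mul (by linarith), ← ENNReal.ofReal_add (by positivity) (by positivity),
    ← ENNReal.ofReal_add (by positivity) (mul_nonneg (by linarith) (sq_nonneg _))]
  refine ENNReal.ofReal_le_ofReal ?_
  -- Young's inequality on the cross term, with weight `b/2` on `a²`, and `b² ≤ b`. After averaging
  -- over the coin, `(1 - b)(1 + b/2) ≤ 1 - b/2` and the constants sum to at most `43/100 < 1/2`.
  have e1 : (a + p.b * p.ε / 10) ^ 2 ≤ (1 + p.b / 2) * a ^ 2 + 3 / 100 * (p.b * p.ε ^ 2) := by
    nlinarith [mul_nonneg hb.le (sq_nonneg (5 * a - p.ε)),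
      mul_nonneg hb.le (mul_nonneg h1b (sq_nonneg p.ε))]
  have e2 : (1 - p.b) * ((a + p.b * p.ε / 10) ^ 2 + p.b * p.ε ^ 2 / 5) ≤
      (1 - p.b) * ((1 + p.b / 2) * a ^ 2 + 23 / 100 * (p.b * p.ε ^ 2)) := by
    refine mul_le_mul_of_nonneg_left ?_ h1b
    linarith
  have e3 : 0 ≤ p.b * (p.b * p.ε ^ 2) := by positivity
  have e4 : 0 ≤ p.b * p.b * a ^ 2 := by positivity
  have e5 : 0 ≤ p.b * p.ε ^ 2 := by positivity
  linarith

end Estimators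

/-! ### Runs of the algorithm -/

section Run

variable {p : Params} {Z : Type*} [MeasurableSpace Z] {O : Oracle p.d Z} {F : Pt p.d → ℝ}
  {solve : ℕ → Pt p.d → Pt p.d → Op p.d → Pt p.d}

/-! ### The iterates as measurable functions of the past seeds -/

section Iterates

variable (O solve)

/-- The iterate `x⁽ᵗ⁺¹⁾`, its predecessor and the last gradient estimate. -/
def iterates (t : ℕ) (r : ℕ → RoundSeed Z) : Pt p.d × Pt p.d × Pt p.d :=
  ((stateAfter p O solve r t).x, (stateAfter p O solve r t).xprev,
    (stateAfter p O solve r t).g.getD 0)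

theorem stateAfter_congr (t : ℕ) {r r' : ℕ → RoundSeed Z} (h : ∀ i < t, r i = r' i) :
    stateAfter p O solve r t = stateAfter p O solve r' t := by
  induction t with
  | zero => rfl
  | succ t ih =>
    simp only [stateAfter]
    rw [ih fun i hi => h i (hi.trans t.lt_succ_self), h t t.lt_succ_self]

theorem iterates_congr (t : ℕ) (r r' : ℕ → RoundSeed Z) (h : ∀ i < t, r i = r' i) :
    iterates O solve t r = iterates O solve t r' := by
  simp only [iterates, stateAfter_congr O solve t h]

/-- Before the first round no gradient is stored, so the coin has no effect and a full batch is
drawn. -/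
theorem iterates_succ_g_zero (r : ℕ → RoundSeed Z) :
    (iterates O solve 1 r).2.2 = gradientEstimate p O (r 0).2.2 (iterates O solve 0 r).1 :=
  congrArg Prod.fst (hvpRVR_none O (r 0).1 (r 0).2.2 0 0)

/-- From the first round on the stored gradient is a genuine `some`, so the default `0` in
`iterates` never enters the algorithm. -/
theorem iterates_succ_g_succ (t : ℕ) (r : ℕ → RoundSeed Z) :
    (iterates O solve (t + 2) r).2.2 =
      (hvpRVR p O (r (t + 1)).1 (r (t + 1)).2.2 (iterates O solve (t + 1) r).1
        (iterates O solve (t + 1) r).2.1 (some (iterates O solve (t + 1) r).2.2)).1 := rfl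

theorem iterates_succ_x (t : ℕ) (r : ℕ → RoundSeed Z) :
    (iterates O solve (t + 1) r).1 =
      solve (t + 1) (iterates O solve t r).1 (iterates O solve (t + 1) r).2.2
        (hessianEstimate p O (r t).2.1 (iterates O solve t r).1) := rfl

theorem iterates_succ_xprev (t : ℕ) (r : ℕ → RoundSeed Z) :
    (iterates O solve (t + 1) r).2.1 = (iterates O solve t r).1 := rfl

variable {solve}

theorem measurable_iterates (hs : IsCubicSolver p solve) (t : ℕ) :
    Measurable (iterates O solve t) := by
  induction t with
  | zero =>
    have h : iterates O solve 0 = fun _ => (0, 0, 0) := rfl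
    rw [h]
    exact measurable_const
  | succ t ih =>
    have hx : Measurable fun r => (iterates O solve t r).1 := measurable_fst.comp ih
    have hxp : Measurable fun r => (iterates O solve t r).2.1 :=
      measurable_fst.comp (measurable_snd.comp ih)
    have hr : Measurable fun r : ℕ → RoundSeed Z => r t := measurable_pi_apply t
    have hg : Measurable fun r => (iterates O solve (t + 1) r).2.2 := by
      cases t with
      | zero =>
        have h : (fun r => (iterates O solve (0 + 1) r).2.2) = fun r =>
            gradientEstimate p O (r 0).2.2 (iterates O solve 0 r).1 :=
          funext (iterates_succ_g_zero O solve)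
        rw [h]
        have h1 := (measurable_gradientEstimate p O).comp
          ((measurable_snd.comp (measurable_snd.comp hr)).prodMk hx)
        simpa only [Function.comp_def] using h1
      | succ t =>
        have h : (fun r => (iterates O solve (t + 1 + 1) r).2.2) = fun r =>
            (hvpRVR p O (r (t + 1)).1 (r (t + 1)).2.2 (iterates O solve (t + 1) r).1
              (iterates O solve (t + 1) r).2.1 (some (iterates O solve (t + 1) r).2.2)).1 :=
          funext (iterates_succ_g_succ O solve t)
        rw [h]
        have hg : Measurable fun r => (iterates O solve (t + 1) r).2.2 :=
          measurable_snd.comp (measurable_snd.comp ih)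
        have hc : Measurable fun r : ℕ → RoundSeed Z => (r (t + 1)).1 := measurable_fst.comp hr
        have hz : Measurable fun r : ℕ → RoundSeed Z => (r (t + 1)).2.2 :=
          measurable_snd.comp (measurable_snd.comp hr)
        have h1 := (measurable_hvpRVR_some p O).comp
          (hc.prodMk (hz.prodMk (hx.prodMk (hxp.prodMk hg))))
        simpa only [Function.comp_def] using h1
    have hH : Measurable fun r : ℕ → RoundSeed Z =>
        hessianEstimate p O (r t).2.1 (iterates O solve t r).1 := by
      have h1 := (measurable_hessianEstimate p O).comp
        ((measurable_fst.comp (measurable_snd.comp hr)).prodMk hx)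
      simpa only [Function.comp_def] using h1
    have hy : Measurable fun r => (iterates O solve (t + 1) r).1 := by
      simp only [iterates_succ_x]
      simpa only [Function.comp_def] using (hs.measurable (t + 1)).comp (hx.prodMk (hg.prodMk hH))
    have h : iterates O solve (t + 1) = fun r => ((iterates O solve (t + 1) r).1,
        (iterates O solve t r).1, (iterates O solve (t + 1) r).2.2) := by
      have hq : ∀ (q : Pt p.d × Pt p.d × Pt p.d) (x : Pt p.d), q.2.1 = x → q = (q.1, x, q.2.2) := by
        rintro ⟨a, b, c⟩ x rfl
        rfl
      exact funext fun r => hq _ _ (iterates_succ_xprev O solve t r)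
    rw [h]
    exact hy.prodMk (hx.prodMk hg)

end Iterates

variable (p O) in
/-- The law of the randomness of all rounds. -/
def runLaw : Measure (ℕ → RoundSeed Z) := Measure.infinitePi fun _ : ℕ => roundLaw p O

instance : IsProbabilityMeasure (runLaw p O) := by
  unfold runLaw; infer_instance

variable (O F solve) in
/-- The error of the gradient estimate of round `t + 1`. -/
def gradError (t : ℕ) (r : ℕ → RoundSeed Z) : ℝ :=
  ‖(iterates O solve (t + 1) r).2.2 - gradient F (iterates O solve t r).1‖

variable (O F solve) in
/-- The error of the Hessian estimate of round `t + 1`. -/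
def hessError (t : ℕ) (r : ℕ → RoundSeed Z) : ℝ :=
  ‖hessianEstimate p O (r t).2.1 (iterates O solve t r).1 - hessian F (iterates O solve t r).1‖

theorem measurable_gradError {Δ L : ℝ} (hF : InFunctionClass Δ L F)
    (hs : IsCubicSolver p solve) (t : ℕ) : Measurable (gradError O F solve t) :=
  ((measurable_snd.comp (measurable_snd.comp (measurable_iterates O hs (t + 1)))).sub
    (hF.continuous_gradient.measurable.comp
      (measurable_fst.comp (measurable_iterates O hs t)))).norm

theorem measurable_hessError {Δ L : ℝ} (hF : InFunctionClass Δ L F)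
    (hs : IsCubicSolver p solve) (t : ℕ) : Measurable (hessError O F solve t) := by
  have hx := measurable_fst.comp (measurable_iterates O hs t)
  have hr : Measurable fun r : ℕ → RoundSeed Z => (r t).2.1 :=
    measurable_fst.comp (measurable_snd.comp (measurable_pi_apply t))
  exact (((measurable_hessianEstimate p O).comp (hr.prodMk hx)).sub
    (hF.continuous_hessian.measurable.comp hx)).norm

/-- The iterate is determined by earlier seeds and the Hessian samples are fresh, so the fixed-point
bound can be integrated over the past. -/
theorem lintegral_hessError_le {Δ L : ℝ} (hp : p.Admissible) (hF : InFunctionClass Δ L F)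
    (hO : InOracleClass F p.σ₁ p.σ₂ O) (hs : IsCubicSolver p solve) (t : ℕ) :
    ∫⁻ r, ENNReal.ofReal (hessError O F solve t r ^ 2) ∂(runLaw p O) ≤
      ENNReal.ofReal (p.ε ^ 2 / p.η ^ 2) := by
  have hH : Measurable fun q : (ℕ → Z) × Pt p.d =>
      ENNReal.ofReal (‖hessianEstimate p O q.1 q.2 - hessian F q.2‖ ^ 2) :=
    (((measurable_hessianEstimate p O).sub
      (hF.continuous_hessian.measurable.comp measurable_snd)).norm.pow_const 2).ennreal_ofReal
  have hf : Measurable fun q : (Pt p.d × Pt p.d × Pt p.d) × RoundSeed Z =>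
      ENNReal.ofReal (‖hessianEstimate p O q.2.2.1 q.1.1 - hessian F q.1.1‖ ^ 2) :=
    hH.comp (f := fun q : (Pt p.d × Pt p.d × Pt p.d) × RoundSeed Z => (q.2.2.1, q.1.1))
      (by fun_prop)
  have h := lintegral_stream_split (roundLaw p O) (measurable_iterates O hs t) t
    (iterates_congr O solve t) hf
  refine h.le.trans ?_
  refine (lintegral_mono (g := fun _ => ENNReal.ofReal (p.ε ^ 2 / p.η ^ 2)) fun r => ?_).trans
    (by simp)
  refine le_trans (le_of_eq ?_) (lintegral_hessianEstimate_le hp hO (iterates O solve t r).1)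
  exact lintegral_roundLaw_hess (hH.comp measurable_prodMk_right)

/-- The recursion `e ↦ b ε²/2 + (1 - b/2) e` fixes `ε²`, and the first full batch starts below it.
-/
theorem lintegral_gradError_le {Δ : ℝ} (hp : p.Admissible) (hF : InFunctionClass Δ p.L₂ F)
    (hO : InOracleClass F p.σ₁ p.σ₂ O) (hs : IsCubicSolver p solve) (t : ℕ) :
    ∫⁻ r, ENNReal.ofReal (gradError O F solve t r ^ 2) ∂(runLaw p O) ≤
      ENNReal.ofReal (p.ε ^ 2) := by
  have hb := hp.b_pos
  have hb1 := Params.Admissible.b_le_one p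
  have hgm : Measurable (gradient F) := hF.continuous_gradient.measurable
  induction t with
  | zero =>
    have hG : Measurable fun q : (ℕ → Z) × Pt p.d =>
        ENNReal.ofReal (‖gradientEstimate p O q.1 q.2 - gradient F q.2‖ ^ 2) :=
      (((measurable_gradientEstimate p O).sub
        (hgm.comp measurable_snd)).norm.pow_const 2).ennreal_ofReal
    have hf : Measurable fun q : (Pt p.d × Pt p.d × Pt p.d) × RoundSeed Z =>
        ENNReal.ofReal (‖gradientEstimate p O q.2.2.2 q.1.1 - gradient F q.1.1‖ ^ 2) :=
      hG.comp (f := fun q : (Pt p.d × Pt p.d × Pt p.d) × RoundSeed Z => (q.2.2.2, q.1.1))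
        (by fun_prop)
    have h := lintegral_stream_split (roundLaw p O) (measurable_iterates O hs 0) 0
      (iterates_congr O solve 0) hf
    simp only [gradError, zero_add, iterates_succ_g_zero]
    refine h.le.trans ?_
    refine (lintegral_mono (g := fun _ => ENNReal.ofReal (p.ε ^ 2)) fun r => ?_).trans (by simp)
    refine le_trans (le_of_eq ?_) ((lintegral_gradientEstimate_le hp hO
      (iterates O solve 0 r).1).trans (ENNReal.ofReal_le_ofReal (by
        have := sq_nonneg p.ε; linarith)))
    exact lintegral_roundLaw_grad (hG.comp measurable_prodMk_right)
  | succ t ih =>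
    have hR : Measurable fun q : (Pt p.d × Pt p.d × Pt p.d) × RoundSeed Z =>
        (hvpRVR p O q.2.1 q.2.2.2 q.1.1 q.1.2.1 (some q.1.2.2)).1 :=
      (measurable_hvpRVR_some p O).comp
        (f := fun q : (Pt p.d × Pt p.d × Pt p.d) × RoundSeed Z =>
          (q.2.1, q.2.2.2, q.1.1, q.1.2.1, q.1.2.2)) (by fun_prop)
    have hf : Measurable fun q : (Pt p.d × Pt p.d × Pt p.d) × RoundSeed Z =>
        ENNReal.ofReal (‖(hvpRVR p O q.2.1 q.2.2.2 q.1.1 q.1.2.1 (some q.1.2.2)).1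
          - gradient F q.1.1‖ ^ 2) :=
      ((hR.sub (hgm.comp (measurable_fst.comp measurable_fst))).norm.pow_const 2).ennreal_ofReal
    have h := lintegral_stream_split (roundLaw p O) (measurable_iterates O hs (t + 1)) (t + 1)
      (iterates_congr O solve (t + 1)) hf
    refine h.le.trans ?_
    calc _ ≤ ∫⁻ r, (ENNReal.ofReal (p.b * p.ε ^ 2 / 2) + ENNReal.ofReal (1 - p.b / 2) *
            ENNReal.ofReal (gradError O F solve t r ^ 2)) ∂(runLaw p O) :=
          lintegral_mono fun r => lintegral_hvpRVR_some_le hp hF hO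
            (iterates O solve (t + 1) r).1 (iterates O solve (t + 1) r).2.1
            (iterates O solve (t + 1) r).2.2
      _ = ENNReal.ofReal (p.b * p.ε ^ 2 / 2) + ENNReal.ofReal (1 - p.b / 2) *
            ∫⁻ r, ENNReal.ofReal (gradError O F solve t r ^ 2) ∂(runLaw p O) := by
          rw [lintegral_add_left measurable_const, lintegral_const_mul' _ _ ENNReal.ofReal_ne_top]
          simp
      _ ≤ ENNReal.ofReal (p.b * p.ε ^ 2 / 2) + ENNReal.ofReal (1 - p.b / 2) *
            ENNReal.ofReal (p.ε ^ 2) := by gcongr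
      _ = ENNReal.ofReal (p.ε ^ 2) := by
          rw [← ENNReal.ofReal_mul (by linarith), ← ENNReal.ofReal_add (by positivity)
            (mul_nonneg (by linarith) (sq_nonneg _))]
          congr 1
          ring

/-! ### The gradient at the iterates -/

/-- A step that ends at a point with a large gradient either makes much progress or relies on
inaccurate estimates. -/
theorem one_le_of_large_gradient {Δ : ℝ} {x g y : Pt p.d} {H : Op p.d} (hp : p.Admissible)
    (hF : InFunctionClass Δ p.L₂ F) (hH : H ∈ symmetricOp p.d) (hy : ‖y - x‖ ≤ p.η)
    (hmin : ∀ w, ‖w - x‖ ≤ p.η → cubicModel p x g H y ≤ cubicModel p x g H w)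
    (hlarge : 350 * p.ε < ‖gradient F y‖) :
    1 ≤ (F x - F y) / (60 * p.ε * p.η) + 2 / 75 + 1 / (75 * p.ε ^ 2) * ‖g - gradient F x‖ ^ 2 +
      p.η ^ 2 / (75 * p.ε ^ 2) * ‖H - hessian F x‖ ^ 2 := by
  have hε := hp.ε_pos; have hη := hp.η_pos; have hM := hp.M_pos
  have hL := Params.Admissible.L₂_le_M p
  have hMη := hp.M_mul_η_sq
  have hdesc := hF.descent hL hM.le hy hmin
  set ρ := ‖y - x‖
  have hρ : 0 ≤ ρ := norm_nonneg _
  set u := ‖g - gradient F x‖ with hu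
  set w := ‖H - hessian F x‖ with hw
  have hu0 : 0 ≤ u := norm_nonneg _
  have hw0 : 0 ≤ w := norm_nonneg _
  -- Three cases: a boundary step has `M ρ³ = 625 ε η`; errors of total size `100 ε` suffice alone;
  -- otherwise the step is interior and the gradient bound forces it to be long.
  have hprog : 1 ≤ p.M * ρ ^ 3 / (300 * p.ε * p.η) + (u + w * p.η) / (100 * p.ε) := by
    have t1 : 0 ≤ p.M * ρ ^ 3 / (300 * p.ε * p.η) := by positivity
    have t2 : 0 ≤ (u + w * p.η) / (100 * p.ε) := by positivity
    rcases hy.eq_or_lt with h | h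
    · have : 1 ≤ p.M * ρ ^ 3 / (300 * p.ε * p.η) := by
        rw [le_div_iff₀ (by positivity), h]
        nlinarith [mul_pos hε hη]
      linarith
    · by_cases hbig : 100 * p.ε ≤ u + w * p.η
      · have : 1 ≤ (u + w * p.η) / (100 * p.ε) := by
          rw [le_div_iff₀ (by positivity)]; linarith
        linarith
      · have hint := hF.norm_gradient_le hL hM.le hH h hmin
        have h1 : 1250 / 3 * p.ε ≤ p.M * ρ ^ 2 := by
          push Not at hbig
          linarith
        -- A shorter step would give `M ρ² ≤ 16/25 · 625 ε = 400 ε`, below `1250/3 ε`.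
        have h2 : 4 / 5 * p.η ≤ ρ := by
          by_contra hcon
          push Not at hcon
          have : p.M * ρ ^ 2 ≤ p.M * (4 / 5 * p.η) ^ 2 := by gcongr
          nlinarith
        have : 1 ≤ p.M * ρ ^ 3 / (300 * p.ε * p.η) := by
          rw [le_div_iff₀ (by positivity)]
          calc 1 * (300 * p.ε * p.η) ≤ (1250 / 3 * p.ε) * (4 / 5 * p.η) := by
                nlinarith [mul_pos hε hη]
            _ ≤ (p.M * ρ ^ 2) * ρ := by gcongr
            _ = _ := by ring
        linarith
  have h1 : p.M * ρ ^ 3 / (300 * p.ε * p.η) ≤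
      (F x - F y + u * p.η + 1 / 2 * w * p.η ^ 2) / (60 * p.ε * p.η) := by
    rw [div_le_div_iff₀ (by positivity) (by positivity)]
    nlinarith [mul_le_mul_of_nonneg_right hdesc (mul_pos hε hη).le]
  have h2 : (F x - F y + u * p.η + 1 / 2 * w * p.η ^ 2) / (60 * p.ε * p.η) =
      (F x - F y) / (60 * p.ε * p.η) + 1 / 60 * (u / p.ε) + 1 / 120 * (p.η * w / p.ε) := by
    field_simp
    ring
  have h3 : (u + w * p.η) / (100 * p.ε) = 1 / 100 * (u / p.ε) + 1 / 100 * (p.η * w / p.ε) := by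
    field_simp
  have h4 : 1 / (75 * p.ε ^ 2) * u ^ 2 = 1 / 75 * (u / p.ε) ^ 2 := by field_simp
  have h5 : p.η ^ 2 / (75 * p.ε ^ 2) * w ^ 2 = 1 / 75 * (p.η * w / p.ε) ^ 2 := by field_simp
  rw [h4, h5]
  have h6 : 0 ≤ p.η * w / p.ε := by positivity
  -- The linear coefficients of `u/ε` and `η w/ε` are at most `1/60 + 1/100 = 2/75`, and `2 s ≤ s² +
  -- 1`; the two constants `1/75` make the `2/75`.
  nlinarith [sq_nonneg (u / p.ε - 1), sq_nonneg (p.η * w / p.ε - 1)]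

variable (O F solve) in
/-- The event that the iterate `x⁽ᵗ⁺²⁾` has a large gradient. -/
def largeGradient (t : ℕ) : Set (ℕ → RoundSeed Z) :=
  {r | 350 * p.ε < ‖gradient F (iterates O solve (t + 1) r).1‖}

theorem measurableSet_largeGradient {Δ L : ℝ} (hF : InFunctionClass Δ L F)
    (hs : IsCubicSolver p solve) (t : ℕ) : MeasurableSet (largeGradient O F solve t) :=
  measurableSet_lt measurable_const (hF.continuous_gradient.measurable.comp
    (measurable_fst.comp (measurable_iterates O hs (t + 1)))).norm

/-- The one-step inequality must hold in every round, with left side `0` when the gradient is small,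
so that the decreases of `F` telescope over the whole run. The constant `11/300` is `1/100` from the
telescoped gap plus `2/75`. -/
theorem sum_indicator_largeGradient_le (hp : p.Admissible) (hF : InFunctionClass p.Δ p.L₂ F)
    (hO : InOracleClass F p.σ₁ p.σ₂ O) (hs : IsCubicSolver p solve) (r : ℕ → RoundSeed Z) :
    ∑ t ∈ Finset.range p.T, (largeGradient O F solve t).indicator (1 : (ℕ → RoundSeed Z) → ENNReal) r ≤
      ENNReal.ofReal (11 / 300 * p.T) + ∑ t ∈ Finset.range p.T,
        (ENNReal.ofReal (1 / (75 * p.ε ^ 2)) * ENNReal.ofReal (gradError O F solve t r ^ 2) +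
          ENNReal.ofReal (p.η ^ 2 / (75 * p.ε ^ 2)) *
            ENNReal.ofReal (hessError O F solve t r ^ 2)) := by
  classical
  have hε := hp.ε_pos; have hη := hp.η_pos; have hM := hp.M_pos
  set X : ℕ → Pt p.d := fun t => (iterates O solve t r).1 with hX
  have hle : ∀ t, (if r ∈ largeGradient O F solve t then (1 : ℝ) else 0) ≤
      (F (X t) - F (X (t + 1))) / (60 * p.ε * p.η) + 2 / 75
        + 1 / (75 * p.ε ^ 2) * gradError O F solve t r ^ 2
        + p.η ^ 2 / (75 * p.ε ^ 2) * hessError O F solve t r ^ 2 := fun t => by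
    have hball : ‖X (t + 1) - X t‖ ≤ p.η := hs.mem_ball (t + 1) (X t) _ _
    have hmin : ∀ w, ‖w - X t‖ ≤ p.η →
      cubicModel p (X t) (iterates O solve (t + 1) r).2.2
        (hessianEstimate p O (r t).2.1 (X t)) (X (t + 1)) ≤
      cubicModel p (X t) (iterates O solve (t + 1) r).2.2
        (hessianEstimate p O (r t).2.1 (X t)) w := fun w hw => hs.isMin (t + 1) (X t) _ _ w hw
    split_ifs with h
    · exact one_le_of_large_gradient hp hF (hessianEstimate_mem hO _ _) hball hmin h
    · have hdesc := hF.descent (Params.Admissible.L₂_le_M p) hM.le hball hmin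
      change _ ≤ F (X t) - F (X (t + 1)) + gradError O F solve t r * p.η
        + 1 / 2 * hessError O F solve t r * p.η ^ 2 at hdesc
      set u := gradError O F solve t r
      set w := hessError O F solve t r
      -- Even without progress, `F` can increase by no more than the estimation errors allow.
      have h0 : 0 ≤ (F (X t) - F (X (t + 1)) + u * p.η + 1 / 2 * w * p.η ^ 2) /
          (60 * p.ε * p.η) :=
        div_nonneg (le_trans (by positivity) hdesc) (by positivity)
      have h2 : (F (X t) - F (X (t + 1)) + u * p.η + 1 / 2 * w * p.η ^ 2) / (60 * p.ε * p.η) =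
          (F (X t) - F (X (t + 1))) / (60 * p.ε * p.η) + 1 / 60 * (u / p.ε)
            + 1 / 120 * (p.η * w / p.ε) := by
        field_simp
        ring
      have h4 : 1 / (75 * p.ε ^ 2) * u ^ 2 = 1 / 75 * (u / p.ε) ^ 2 := by field_simp
      have h5 : p.η ^ 2 / (75 * p.ε ^ 2) * w ^ 2 = 1 / 75 * (p.η * w / p.ε) ^ 2 := by field_simp
      rw [h4, h5]
      nlinarith [sq_nonneg (u / p.ε - 1), sq_nonneg (p.η * w / p.ε - 1)]
  have hsum := Finset.sum_le_sum fun t (_ : t ∈ Finset.range p.T) => hle t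
  have htel : ∑ t ∈ Finset.range p.T, (F (X t) - F (X (t + 1))) ≤ p.Δ := by
    rw [Finset.sum_range_sub' (fun t => F (X t))]
    have h1 : F (X 0) = F 0 := rfl
    have h2 : (⨅ x, F x) ≤ F (X p.T) := ciInf_le hF.bddBelow _
    have := hF.gap
    linarith
  have hΔ : p.Δ / (60 * p.ε * p.η) ≤ p.T / 100 := by
    rw [div_le_div_iff₀ (by positivity) (by norm_num)]
    have := hp.Δ_le
    nlinarith
  have htotal : ∑ t ∈ Finset.range p.T, (if r ∈ largeGradient O F solve t then (1 : ℝ) else 0) ≤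
      11 / 300 * p.T + ∑ t ∈ Finset.range p.T,
        (1 / (75 * p.ε ^ 2) * gradError O F solve t r ^ 2
          + p.η ^ 2 / (75 * p.ε ^ 2) * hessError O F solve t r ^ 2) := by
    refine hsum.trans ?_
    simp only [add_assoc]
    rw [Finset.sum_add_distrib, ← Finset.sum_div, Finset.sum_add_distrib, Finset.sum_const,
      Finset.card_range, nsmul_eq_mul]
    have : (∑ t ∈ Finset.range p.T, (F (X t) - F (X (t + 1)))) / (60 * p.ε * p.η) ≤
        p.Δ / (60 * p.ε * p.η) := by gcongr
    linarith
  have hcast : ∑ t ∈ Finset.range p.T, (largeGradient O F solve t).indicator (1 : (ℕ → RoundSeed Z) → ENNReal) r =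
      ENNReal.ofReal (∑ t ∈ Finset.range p.T,
        (if r ∈ largeGradient O F solve t then (1 : ℝ) else 0)) := by
    rw [ENNReal.ofReal_sum_of_nonneg fun t _ => by split_ifs <;> simp]
    refine Finset.sum_congr rfl fun t _ => ?_
    by_cases h : r ∈ largeGradient O F solve t <;> simp [h]
  rw [hcast]
  refine (ENNReal.ofReal_le_ofReal htotal).trans (le_of_eq ?_)
  rw [ENNReal.ofReal_add (by positivity) (Finset.sum_nonneg fun t _ => by positivity),
    ENNReal.ofReal_sum_of_nonneg fun t _ => by positivity]
  congr 1
  refine Finset.sum_congr rfl fun t _ => ?_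
  rw [ENNReal.ofReal_add (by positivity) (by positivity), ENNReal.ofReal_mul (by positivity),
    ENNReal.ofReal_mul (by positivity)]

/-- The two mean squared errors contribute `1/75` each per round, and `11/300 + 2/75 = 19/300 <
1/10`. -/
theorem sum_measure_largeGradient_le (hp : p.Admissible) (hF : InFunctionClass p.Δ p.L₂ F)
    (hO : InOracleClass F p.σ₁ p.σ₂ O) (hs : IsCubicSolver p solve) :
    ∑ t ∈ Finset.range p.T, runLaw p O (largeGradient O F solve t) ≤
      ENNReal.ofReal (p.T / 10) := by
  have hε := hp.ε_pos; have hη := hp.η_pos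
  have hmg : ∀ t, Measurable fun r => ENNReal.ofReal (gradError O F solve t r ^ 2) := fun t =>
    ((measurable_gradError hF hs t).pow_const 2).ennreal_ofReal
  have hmh : ∀ t, Measurable fun r => ENNReal.ofReal (hessError O F solve t r ^ 2) := fun t =>
    ((measurable_hessError hF hs t).pow_const 2).ennreal_ofReal
  have hm : ∀ t ∈ Finset.range p.T, Measurable fun r =>
      ENNReal.ofReal (1 / (75 * p.ε ^ 2)) * ENNReal.ofReal (gradError O F solve t r ^ 2) +
        ENNReal.ofReal (p.η ^ 2 / (75 * p.ε ^ 2)) *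
          ENNReal.ofReal (hessError O F solve t r ^ 2) := fun t _ =>
    ((hmg t).const_mul _).add ((hmh t).const_mul _)
  calc ∑ t ∈ Finset.range p.T, runLaw p O (largeGradient O F solve t)
      = ∫⁻ r, ∑ t ∈ Finset.range p.T, (largeGradient O F solve t).indicator (1 : (ℕ → RoundSeed Z) → ENNReal) r
          ∂(runLaw p O) := by
        rw [lintegral_finsetSum _ fun t _ =>
          measurable_one.indicator (measurableSet_largeGradient hF hs t)]
        simp_rw [lintegral_indicator_one (measurableSet_largeGradient hF hs _)]
    _ ≤ _ := lintegral_mono (sum_indicator_largeGradient_le hp hF hO hs)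
    _ = ENNReal.ofReal (11 / 300 * p.T) + ∑ t ∈ Finset.range p.T,
        (ENNReal.ofReal (1 / (75 * p.ε ^ 2)) *
            ∫⁻ r, ENNReal.ofReal (gradError O F solve t r ^ 2) ∂(runLaw p O) +
          ENNReal.ofReal (p.η ^ 2 / (75 * p.ε ^ 2)) *
            ∫⁻ r, ENNReal.ofReal (hessError O F solve t r ^ 2) ∂(runLaw p O)) := by
        rw [lintegral_add_left measurable_const, lintegral_finsetSum _ hm]
        congr 1
        · simp
        · refine Finset.sum_congr rfl fun t _ => ?_
          rw [lintegral_add_left ((hmg t).const_mul _), lintegral_const_mul _ (hmg t),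
            lintegral_const_mul _ (hmh t)]
    _ ≤ ENNReal.ofReal (11 / 300 * p.T) + ∑ t ∈ Finset.range p.T, ENNReal.ofReal (2 / 75) := by
        gcongr with t _
        calc _ ≤ ENNReal.ofReal (1 / (75 * p.ε ^ 2)) * ENNReal.ofReal (p.ε ^ 2) +
              ENNReal.ofReal (p.η ^ 2 / (75 * p.ε ^ 2)) *
                ENNReal.ofReal (p.ε ^ 2 / p.η ^ 2) := by
              gcongr
              · exact lintegral_gradError_le hp hF hO hs t
              · exact lintegral_hessError_le hp hF hO hs t
          _ = ENNReal.ofReal (2 / 75) := by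
              rw [← ENNReal.ofReal_mul (by positivity), ← ENNReal.ofReal_mul (by positivity),
                ← ENNReal.ofReal_add (by positivity) (by positivity)]
              congr 1
              field_simp
              norm_num
    _ ≤ _ := by
        rw [Finset.sum_const, Finset.card_range, nsmul_eq_mul, ← ENNReal.ofReal_natCast,
          ← ENNReal.ofReal_mul (by positivity), ← ENNReal.ofReal_add (by positivity)
            (by positivity)]
        refine ENNReal.ofReal_le_ofReal ?_
        have : (0 : ℝ) ≤ p.T := by positivity
        linarith

end Run

/-! ### The number of queries -/

/-- The largest possible number of Hessian-vector products in a round. -/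
def Params.Kmax (p : Params) : ℕ :=
  ⌈5 * (p.σ₂ ^ 2 + p.L₂ * p.ε) / (p.b * p.ε ^ 2) * p.η ^ 2⌉₊

/-- An upper bound for the expected number of queries. -/
def Params.meanQueries (p : Params) : ℝ := p.T * (p.nH + p.Kmax + p.n * p.b) + p.n

section Queries

variable {p : Params} {Z : Type*} [MeasurableSpace Z] {O : Oracle p.d Z} {F : Pt p.d → ℝ}
  {solve : ℕ → Pt p.d → Pt p.d → Op p.d → Pt p.d}

theorem Params.Admissible.K_le_Kmax (hp : p.Admissible) {x y : Pt p.d} (h : ‖x - y‖ ≤ p.η) :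
    p.K x y ≤ p.Kmax := by
  have := hp.b_pos; have := hp.L₂_nonneg; have := hp.ε_pos
  refine Nat.ceil_mono ?_
  gcongr

/-- Steps never exceed `η`, so each path sum costs at most `Kmax` and only the coins stay random.
The extra `n` pays for the first round, whose batch is drawn whatever its coin shows. -/
theorem queries_succ_le (hp : p.Admissible) (hs : IsCubicSolver p solve) (t : ℕ)
    (r : ℕ → RoundSeed Z) :
    (stateAfter p O solve r (t + 1)).queries ≤ (t + 1) * (p.nH + p.Kmax) + p.n +
      p.n * ∑ i ∈ Finset.range (t + 1), if (r i).1 then 1 else 0 := by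
  induction t with
  | zero =>
    have h : (stateAfter p O solve r (0 + 1)).queries = 0 + p.nH + p.n :=
      congrArg (fun e : Pt p.d × ℕ => 0 + p.nH + e.2) (hvpRVR_none O (r 0).1 (r 0).2.2 0 0)
    rw [h]
    have := Nat.zero_le (p.n * ∑ i ∈ Finset.range (0 + 1), if (r i).1 then 1 else 0)
    simp only [zero_add, one_mul] at this ⊢
    omega
  | succ t ih =>
    set s := stateAfter p O solve r (t + 1) with hsdef
    have h : (stateAfter p O solve r (t + 1 + 1)).queries = s.queries + p.nH +
      (hvpRVR p O (r (t + 1)).1 (r (t + 1)).2.2 s.x s.xprev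
        (some (iterates O solve (t + 1) r).2.2)).2 := rfl
    have hball : ‖s.x - s.xprev‖ ≤ p.η := hs.mem_ball (t + 1) _ _ _
    have hK := hp.K_le_Kmax hball
    have hq : (hvpRVR p O (r (t + 1)).1 (r (t + 1)).2.2 s.x s.xprev
        (some (iterates O solve (t + 1) r).2.2)).2 ≤
        p.Kmax + p.n * if (r (t + 1)).1 then 1 else 0 := by
      cases (r (t + 1)).1 with
      | true => rw [hvpRVR_true]; simp
      | false => rw [hvpRVR_false]; simpa using hK
    rw [h, Finset.sum_range_succ, mul_add p.n]
    have e : (t + 1 + 1) * (p.nH + p.Kmax) = (t + 1) * (p.nH + p.Kmax) + p.nH + p.Kmax := by ring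
    rw [e]
    omega

theorem lintegral_coin (hp : p.Admissible) (i : ℕ) :
    ∫⁻ r, (if (r i).1 then 1 else 0 : ENNReal) ∂(runLaw p O) = ENNReal.ofReal p.b := by
  have hm : Measurable fun s : RoundSeed Z => (if s.1 then 1 else 0 : ENNReal) :=
    (measurable_from_top (f := fun c : Bool => (if c then 1 else 0 : ENNReal))).comp measurable_fst
  have h := (measurePreserving_eval_infinitePi (fun _ : ℕ => roundLaw p O) i).lintegral_comp hm
  refine h.trans ?_
  rw [lintegral_roundLaw hp hm]
  simp

theorem measurable_coin (i : ℕ) :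
    Measurable fun r : ℕ → RoundSeed Z => (if (r i).1 then 1 else 0 : ENNReal) :=
  (measurable_from_top (f := fun c : Bool => (if c then 1 else 0 : ENNReal))).comp
    (measurable_fst.comp (measurable_pi_apply i))

variable (p) in
/-- An upper bound for the number of queries that depends on the coins only. -/
def queryBound (r : ℕ → RoundSeed Z) : ENNReal :=
  (p.T * (p.nH + p.Kmax) + p.n : ℕ) +
    p.n * ∑ i ∈ Finset.range p.T, if (r i).1 then 1 else 0

theorem lintegral_queryBound (hp : p.Admissible) :
    ∫⁻ r, queryBound p r ∂(runLaw p O) = ENNReal.ofReal p.meanQueries := by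
  have hb := hp.b_pos
  simp only [queryBound]
  rw [lintegral_add_left measurable_const,
    lintegral_const_mul _ (Finset.measurable_sum _ fun i _ => measurable_coin i),
    lintegral_finsetSum _ fun i _ => measurable_coin i]
  simp only [lintegral_coin hp, lintegral_const, measure_univ, mul_one, Finset.sum_const,
    Finset.card_range, nsmul_eq_mul]
  rw [← ENNReal.ofReal_natCast, ← ENNReal.ofReal_natCast, ← ENNReal.ofReal_natCast,
    ← ENNReal.ofReal_mul (by positivity), ← ENNReal.ofReal_mul (by positivity),
    ← ENNReal.ofReal_add (by positivity) (by positivity), Params.meanQueries]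
  congr 1
  push_cast
  ring

theorem Params.Admissible.meanQueries_pos (hp : p.Admissible) : 0 < p.meanQueries := by
  have := hp.b_pos
  have h : (0 : ℝ) < p.n := by exact_mod_cast hp.n_pos
  rw [Params.meanQueries]
  positivity

theorem measure_queryBound_le (hp : p.Admissible) :
    runLaw p O {r | ENNReal.ofReal (10 * p.meanQueries) ≤ queryBound p r} ≤
      ENNReal.ofReal (1 / 10) := by
  have hB := hp.meanQueries_pos
  have hm : Measurable fun r : ℕ → RoundSeed Z => queryBound p r :=
    ((Finset.measurable_sum _ fun i _ => measurable_coin i).const_mul _).const_add _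
  refine (meas_ge_le_lintegral_div hm.aemeasurable (by positivity)
    ENNReal.ofReal_ne_top).trans ?_
  rw [lintegral_queryBound hp, ← ENNReal.ofReal_div_of_pos (by positivity)]
  refine ENNReal.ofReal_le_ofReal (le_of_eq ?_)
  field_simp

theorem ofReal_le_queryBound (hp : p.Admissible) (hs : IsCubicSolver p solve)
    {r : ℕ → RoundSeed Z} {B : ℝ} (h : B < (stateAfter p O solve r p.T).queries) :
    ENNReal.ofReal B ≤ queryBound p r := by
  obtain ⟨t, ht⟩ : ∃ t, p.T = t + 1 := ⟨p.T - 1, by have := hp.T_pos; omega⟩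
  have hq := queries_succ_le (O := O) hp hs t r
  rw [← ht] at hq
  have h1 : queryBound p r = ((p.T * (p.nH + p.Kmax) + p.n +
      p.n * ∑ i ∈ Finset.range p.T, if (r i).1 then 1 else 0 : ℕ) : ENNReal) := by
    simp only [queryBound]
    push_cast
    rfl
  rw [h1, ← ENNReal.ofReal_natCast]
  exact ENNReal.ofReal_le_ofReal (h.le.trans (by exact_mod_cast hq))

/-! ### The returned point -/

/-- The shift `i = t + 2` aligns the output index with `largeGradient`, which speaks of `x⁽ᵗ⁺²⁾`. -/
theorem lintegral_uniformOn_Icc {T : ℕ} (f : ℕ → ENNReal) :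
    ∫⁻ i, f i ∂(uniformOn (Set.Icc 2 (T + 1))) =
      (T : ENNReal)⁻¹ * ∑ t ∈ Finset.range T, f (t + 2) := by
  have hIcc : Set.Icc 2 (T + 1) = ((Finset.Icc 2 (T + 1) : Finset ℕ) : Set ℕ) := by simp
  rw [uniformOn, ProbabilityTheory.cond, lintegral_smul_measure, hIcc, lintegral_finset,
    Measure.count_apply_finset]
  simp only [Measure.count_singleton, mul_one, Nat.card_Icc, smul_eq_mul]
  congr 1
  refine Finset.sum_nbij' (fun i => i - 2) (fun t => t + 2) ?_ ?_ ?_ ?_ ?_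
  · intro i hi; simp only [Finset.mem_Icc, Finset.mem_range] at *; omega
  · intro i hi; simp only [Finset.mem_Icc, Finset.mem_range] at *; omega
  · intro i hi; simp only [Finset.mem_Icc] at *; omega
  · intro i hi; simp
  · intro i hi
    simp only [Finset.mem_Icc] at hi
    rw [Nat.sub_add_cancel hi.1]

theorem isProbabilityMeasure_uniformOn_Icc {T : ℕ} (hT : 0 < T) :
    IsProbabilityMeasure (uniformOn (Set.Icc 2 (T + 1))) :=
  isProbabilityMeasure_uniformOn (Set.finite_Icc _ _) ⟨2, by simp; omega⟩

theorem seedLaw_largeGradient_le (hp : p.Admissible) (hF : InFunctionClass p.Δ p.L₂ F)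
    (hO : InOracleClass F p.σ₁ p.σ₂ O) (hs : IsCubicSolver p solve) :
    seedLaw p O {ω | 350 * p.ε < ‖gradient F (output p O solve ω)‖} ≤
      ENNReal.ofReal (1 / 10) := by
  have := isProbabilityMeasure_uniformOn_Icc hp.T_pos
  have hT : (0 : ℝ) < p.T := by exact_mod_cast hp.T_pos
  have hm : MeasurableSet {ω : Seed Z | 350 * p.ε < ‖gradient F (output p O solve ω)‖} := by
    refine measurableSet_lt measurable_const (hF.continuous_gradient.measurable.comp ?_).norm
    exact measurable_from_prod_countable_left fun i =>
      measurable_fst.comp (measurable_iterates O hs (i - 1))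
  have h := Measure.prod_apply_symm (μ := runLaw p O)
    (ν := uniformOn (Set.Icc 2 (p.T + 1))) hm
  refine h.le.trans ?_
  rw [lintegral_uniformOn_Icc]
  calc _ ≤ (p.T : ENNReal)⁻¹ * ENNReal.ofReal (p.T / 10) := by
        gcongr
        exact sum_measure_largeGradient_le hp hF hO hs
    _ = ENNReal.ofReal (1 / 10) := by
        rw [← ENNReal.ofReal_natCast, ← ENNReal.ofReal_inv_of_pos hT,
          ← ENNReal.ofReal_mul (by positivity)]
        congr 1
        field_simp

/-- The algorithm with precision parameter `ε` returns with probability at least `3 / 4` a point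
with gradient at most `350 ε` after at most ten times the expected number of queries. -/
theorem three_fourths_le_seedLaw (hp : p.Admissible) (hF : InFunctionClass p.Δ p.L₂ F)
    (hO : InOracleClass F p.σ₁ p.σ₂ O) (hs : IsCubicSolver p solve) {B : ℝ}
    (hB : 10 * p.meanQueries ≤ B) :
    3 / 4 ≤ seedLaw p O {ω | ‖gradient F (output p O solve ω)‖ ≤ 350 * p.ε ∧
      (totalQueries p O solve ω : ℝ) ≤ B} := by
  have := isProbabilityMeasure_uniformOn_Icc hp.T_pos
  have : IsProbabilityMeasure (seedLaw p O) :=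
    inferInstanceAs (IsProbabilityMeasure ((runLaw p O).prod (uniformOn (Set.Icc 2 (p.T + 1)))))
  set good := {ω | ‖gradient F (output p O solve ω)‖ ≤ 350 * p.ε ∧
      (totalQueries p O solve ω : ℝ) ≤ B} with hgood
  set S := {r : ℕ → RoundSeed Z | ENNReal.ofReal (10 * p.meanQueries) ≤ queryBound p r} with hS
  have hS' : seedLaw p O (S ×ˢ Set.univ) ≤ ENNReal.ofReal (1 / 10) := by
    have h : seedLaw p O (S ×ˢ Set.univ) =
        runLaw p O S * uniformOn (Set.Icc 2 (p.T + 1)) Set.univ := Measure.prod_prod _ _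
    rw [h, measure_univ, mul_one]
    exact measure_queryBound_le hp
  -- Covering the whole space and using subadditivity bounds the good event from below without
  -- showing it measurable.
  have hsub : Set.univ ⊆ good ∪ ({ω | 350 * p.ε < ‖gradient F (output p O solve ω)‖} ∪
      S ×ˢ Set.univ) := by
    intro ω _
    by_cases h1 : ‖gradient F (output p O solve ω)‖ ≤ 350 * p.ε
    · by_cases h2 : (totalQueries p O solve ω : ℝ) ≤ B
      · exact Or.inl ⟨h1, h2⟩
      · exact Or.inr (Or.inr ⟨ofReal_le_queryBound hp hs (hB.trans_lt (not_le.1 h2)), trivial⟩)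
    · exact Or.inr (Or.inl (not_le.1 h1))
  have htot : 1 ≤ seedLaw p O good + ENNReal.ofReal (1 / 5) := by
    calc (1 : ENNReal) = seedLaw p O Set.univ := measure_univ.symm
      _ ≤ _ := measure_mono hsub
      _ ≤ seedLaw p O good + (seedLaw p O _ + seedLaw p O _) :=
          (measure_union_le _ _).trans (add_le_add le_rfl (measure_union_le _ _))
      _ ≤ seedLaw p O good + (ENNReal.ofReal (1 / 10) + ENNReal.ofReal (1 / 10)) := by
          gcongr
          exact seedLaw_largeGradient_le hp hF hO hs
      _ = _ := by
          rw [← ENNReal.ofReal_add (by norm_num) (by norm_num)]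
          norm_num
  have h34 : (3 / 4 : ENNReal) = ENNReal.ofReal (3 / 4) := by
    rw [ENNReal.ofReal_div_of_pos (by norm_num)]
    norm_num
  have hfin : seedLaw p O good = ENNReal.ofReal (seedLaw p O good).toReal :=
    (ENNReal.ofReal_toReal (measure_ne_top _ _)).symm
  rw [h34, hfin]
  rw [hfin, ← ENNReal.ofReal_add ENNReal.toReal_nonneg (by norm_num), ← ENNReal.ofReal_one,
    ENNReal.ofReal_le_ofReal_iff (by positivity)] at htot
  exact ENNReal.ofReal_le_ofReal (by linarith)

end Queries

/-! ### The complexity bound -/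

/-- In this form (*) is equivalent, for `σ₁ > 0`, to `σ₁² / ε²` being at most the complexity. -/
theorem complexity_eq {d : ℕ} {Δ L₂ σ₁ σ₂ ε : ℝ} (hL : 0 ≤ L₂) (hε : 0 < ε) :
    complexity d Δ L₂ σ₁ σ₂ ε = Δ * σ₁ * (σ₂ * √(Real.log d) + √(L₂ * ε)) / ε ^ 3 := by
  have h1 : ε ^ (5 / 2 : ℝ) = ε ^ 2 * √ε := by
    rw [Real.sqrt_eq_rpow, ← Real.rpow_natCast, ← Real.rpow_add hε]
    norm_num
  have h2 : 0 < √ε := Real.sqrt_pos.2 hε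
  have h3 : √ε ^ 2 = ε := Real.sq_sqrt hε.le
  rw [complexity, h1, Real.sqrt_mul hL]
  have h4 : Δ * √L₂ * σ₁ / (ε ^ 2 * √ε) = Δ * σ₁ * (√L₂ * √ε) / ε ^ 3 := by
    rw [div_eq_div_iff (by positivity) (by positivity)]
    linear_combination (-(Δ * √L₂ * σ₁ * ε ^ 2)) * h3
  rw [h4]
  ring

set_option maxHeartbeats 1000000 in
-- With `A = σ₂ √(log d) + √(L₂ ε)`, the scale of the cost of one round is `W = σ₁ η A / ε²`: each
-- of `nH`, `Kmax` and `n b` is a constant times `W`. Multiplying by `Δ / (η ε)` cancels `η` and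
-- yields the complexity. The extra round from rounding up `T` costs a multiple of `W`, itself at
-- most `24 σ₁² / ε²`.
theorem Params.Admissible.meanQueries_le {p : Params} (hp : p.Admissible) :
    p.meanQueries ≤ 25000 * (p.Δ * p.σ₁ * (p.σ₂ * √(Real.log p.d) + √(p.L₂ * p.ε)) / p.ε ^ 3 +
      p.σ₁ ^ 2 / p.ε ^ 2) := by
  have hε := hp.ε_pos; have hη := hp.η_pos; have hσ₁ := hp.σ₁_pos; have hσ₂ := hp.σ₂_pos
  have hL := hp.L₂_nonneg; have hΔ := hp.Δ_pos; have hb := hp.b_pos; have hlog := hp.log_pos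
  have hlt := hp.ε_lt
  have hM := hp.M_pos
  have hMη := hp.M_mul_η_sq
  set ε := p.ε; set η := p.η; set σ₁ := p.σ₁; set σ₂ := p.σ₂
  set l := √(Real.log p.d) with hl
  have hl2 : l ^ 2 = Real.log p.d := Real.sq_sqrt hlog.le
  have hl0 : 4 / 5 ≤ l := by
    refine Real.le_sqrt_of_sq_le ?_
    have h2 : (2 : ℝ) ≤ p.d := by exact_mod_cast hp.two_le_d
    have := Real.log_two_gt_d9
    have := Real.log_le_log (by norm_num) h2
    norm_num
    linarith
  set a := √(p.L₂ * ε) with ha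
  have ha0 : 0 ≤ a := Real.sqrt_nonneg _
  have ha2 : a ^ 2 = p.L₂ * ε := Real.sq_sqrt (by positivity)
  set A := σ₂ * l + a with hA
  have hlpos : 0 < l := by linarith
  have hA0 : 0 < A := by positivity
  set s := √(σ₂ ^ 2 + ε * p.L₂) with hsdef
  have hs2 : s ^ 2 = σ₂ ^ 2 + p.L₂ * ε := by rw [hsdef, Real.sq_sqrt (by positivity)]; ring
  have hs0 : 0 < s := Real.sqrt_pos.2 (by positivity)
  have hsA : s ≤ 5 / 4 * A := by
    refine (sq_le_sq₀ hs0.le (by positivity)).1 ?_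
    rw [hs2, ← ha2]
    have h1 : σ₂ ≤ 5 / 4 * (σ₂ * l) := by nlinarith
    calc σ₂ ^ 2 + a ^ 2 ≤ (σ₂ + a) ^ 2 := by nlinarith [mul_nonneg hσ₂.le ha0]
      _ ≤ (5 / 4 * A) ^ 2 := by
        gcongr
        rw [hA]
        linarith
  have hM1 : 5 * p.L₂ ≤ p.M := Params.Admissible.L₂_le_M p
  have hM2 : 5 * (ε * σ₂ ^ 2 * l ^ 2) ≤ p.M * σ₁ ^ 2 := by
    have : 5 * (ε * σ₂ ^ 2 * Real.log p.d / σ₁ ^ 2) ≤ p.M := by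
      rw [Params.M]
      gcongr
      exact le_max_right _ _
    rw [hl2]
    calc 5 * (ε * σ₂ ^ 2 * Real.log p.d) = 5 * (ε * σ₂ ^ 2 * Real.log p.d / σ₁ ^ 2) * σ₁ ^ 2 := by
          field_simp
      _ ≤ _ := by gcongr
  have hM3 : p.M * ε ≤ 5 * A ^ 2 := by
    have h1 : p.M ≤ 5 * (p.L₂ + ε * σ₂ ^ 2 * l ^ 2 / σ₁ ^ 2) := by
      rw [Params.M, hl2]
      gcongr
      have : 0 ≤ ε * σ₂ ^ 2 * Real.log p.d / σ₁ ^ 2 := by positivity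
      exact max_le (by linarith) (by linarith)
    have h2 : ε * σ₂ ^ 2 * l ^ 2 / σ₁ ^ 2 * ε ≤ σ₂ ^ 2 * l ^ 2 := by
      rw [div_mul_eq_mul_div, div_le_iff₀ (by positivity)]
      calc ε * σ₂ ^ 2 * l ^ 2 * ε = σ₂ ^ 2 * l ^ 2 * ε ^ 2 := by ring
        _ ≤ _ := by gcongr
    calc p.M * ε ≤ 5 * (p.L₂ + ε * σ₂ ^ 2 * l ^ 2 / σ₁ ^ 2) * ε := by gcongr
      _ = 5 * (a ^ 2 + ε * σ₂ ^ 2 * l ^ 2 / σ₁ ^ 2 * ε) := by rw [ha2]; ring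
      _ ≤ 5 * (a ^ 2 + σ₂ ^ 2 * l ^ 2) := by gcongr
      _ ≤ 5 * A ^ 2 := by
        have : 0 ≤ σ₂ * l * a := by positivity
        rw [hA]
        nlinarith
  set y := η * A with hy
  have hy0 : 0 < y := by positivity
  -- This lower bound on `η A` gives `W ≥ 1`, so that the ceilings are absorbed.
  have hylow : ε ≤ y := by
    refine (sq_le_sq₀ hε.le hy0.le).1 ?_
    have : 625 * ε ^ 2 ≤ 5 * y ^ 2 := by
      calc 625 * ε ^ 2 = p.M * ε * η ^ 2 := by linear_combination (-ε) * hMη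
        _ ≤ 5 * A ^ 2 * η ^ 2 := by gcongr
        _ = 5 * y ^ 2 := by rw [hy]; ring
    nlinarith
  -- The two entries of the maximum in `M` give this bound and the next one; `12² ≥ 625/5`.
  have hηa : η * a ≤ 12 * ε := by
    refine (sq_le_sq₀ (by positivity) (by positivity)).1 ?_
    have : 5 * p.L₂ * η ^ 2 * ε ≤ p.M * η ^ 2 * ε := by gcongr
    rw [mul_pow, ha2]
    nlinarith
  have hησ : η * (σ₂ * l) ≤ 12 * σ₁ := by
    refine (sq_le_sq₀ (by positivity) (by positivity)).1 ?_
    have h1 : 5 * (ε * σ₂ ^ 2 * l ^ 2) * η ^ 2 ≤ p.M * σ₁ ^ 2 * η ^ 2 := by gcongr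
    have h2 : ε * (5 * (σ₂ ^ 2 * l ^ 2 * η ^ 2)) ≤ ε * (625 * σ₁ ^ 2) := by
      calc _ = 5 * (ε * σ₂ ^ 2 * l ^ 2) * η ^ 2 := by ring
        _ ≤ p.M * σ₁ ^ 2 * η ^ 2 := h1
        _ = _ := by linear_combination σ₁ ^ 2 * hMη
    have h3 := le_of_mul_le_mul_left h2 hε
    nlinarith
  have hyup : y ≤ 24 * σ₁ := by rw [hy, hA, mul_add]; linarith
  have hηs : η * s ≤ 5 / 4 * y := by
    calc η * s ≤ η * (5 / 4 * A) := by gcongr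
      _ = _ := by rw [hy]; ring
  have hεσ : ε ^ 2 ≤ σ₁ * y := by
    calc ε ^ 2 = ε * ε := sq ε
      _ ≤ σ₁ * y := by gcongr
  set W := σ₁ * y / ε ^ 2 with hW
  have hW1 : 1 ≤ W := by rw [hW, le_div_iff₀ (by positivity)]; linarith
  have hn : (p.n : ℝ) ≤ 6 * (σ₁ ^ 2 / ε ^ 2) := by
    have h1 : (p.n : ℝ) < 5 * σ₁ ^ 2 / ε ^ 2 + 1 := Nat.ceil_lt_add_one (by positivity)
    have h2 : 1 ≤ σ₁ ^ 2 / ε ^ 2 := by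
      rw [le_div_iff₀ (by positivity), one_mul]
      gcongr
    have h3 : 5 * σ₁ ^ 2 / ε ^ 2 = 5 * (σ₁ ^ 2 / ε ^ 2) := by ring
    linarith
  have hnH : (p.nH : ℝ) ≤ 529 * W := by
    have h1 : (p.nH : ℝ) < 22 * σ₂ ^ 2 * η ^ 2 * Real.log p.d / ε ^ 2 + 1 :=
      Nat.ceil_lt_add_one (by positivity)
    have h2 : 22 * σ₂ ^ 2 * η ^ 2 * Real.log p.d / ε ^ 2 ≤ 528 * W := by
      rw [hW, mul_div_assoc']
      refine div_le_div_of_nonneg_right ?_ (by positivity)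
      have h3 : η * (σ₂ * l) ≤ y := by rw [hy, hA]; gcongr; linarith
      calc 22 * σ₂ ^ 2 * η ^ 2 * Real.log p.d = 22 * (η * (σ₂ * l)) ^ 2 := by rw [← hl2]; ring
        _ ≤ 22 * y ^ 2 := by gcongr
        _ ≤ 528 * (σ₁ * y) := by nlinarith
    linarith
  have hK : (p.Kmax : ℝ) ≤ 351 * W := by
    have h1 : (p.Kmax : ℝ) < 5 * (σ₂ ^ 2 + p.L₂ * ε) / (p.b * ε ^ 2) * η ^ 2 + 1 :=
      Nat.ceil_lt_add_one (by positivity)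
    -- Both branches of `b` are needed: if `b = 1`, then `y ≤ 24 σ₁` is used; otherwise `b` cancels
    -- one factor `η s`.
    have h2 : (η * s) ^ 2 ≤ 70 * (σ₁ * y) * p.b := by
      have hbdef : p.b = min 1 (η * s / (25 * σ₁)) := rfl
      rw [hbdef]
      rcases min_cases 1 (η * s / (25 * σ₁)) with ⟨h, _⟩ | ⟨h, _⟩
      · rw [h]
        calc (η * s) ^ 2 ≤ (5 / 4 * y) ^ 2 := by gcongr
          _ ≤ 70 * (σ₁ * y) * 1 := by nlinarith
      · rw [h]
        have : 70 * (σ₁ * y) * (η * s / (25 * σ₁)) = 14 / 5 * y * (η * s) := by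
          field_simp
          norm_num
        rw [this]
        have : 0 < η * s := by positivity
        nlinarith
    have h3 : 5 * (σ₂ ^ 2 + p.L₂ * ε) / (p.b * ε ^ 2) * η ^ 2 ≤ 350 * W := by
      rw [← hs2, hW]
      calc 5 * s ^ 2 / (p.b * ε ^ 2) * η ^ 2 = 5 * (η * s) ^ 2 / (p.b * ε ^ 2) := by ring
        _ ≤ 5 * (70 * (σ₁ * y) * p.b) / (p.b * ε ^ 2) := by gcongr
        _ = 350 * (σ₁ * y / ε ^ 2) := by
          field_simp
          norm_num
    linarith
  have hnb : (p.n : ℝ) * p.b ≤ W := by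
    have h1 : p.b ≤ η * s / (25 * σ₁) := min_le_right _ _
    calc (p.n : ℝ) * p.b ≤ 6 * (σ₁ ^ 2 / ε ^ 2) * (5 / 4 * y / (25 * σ₁)) := by
          gcongr
          exact h1.trans (by gcongr)
      _ = 3 / 10 * W := by
          rw [hW]
          field_simp
          norm_num
      _ ≤ W := by linarith
  have hT : (p.T : ℝ) ≤ 5 * p.Δ / (3 * η * ε) + 1 :=
    (Nat.ceil_lt_add_one (by positivity)).le
  have hWΔ : 5 * p.Δ / (3 * η * ε) * W = 5 / 3 * (p.Δ * σ₁ * A / ε ^ 3) := by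
    rw [hW, hy]
    field_simp
  have hWσ : W ≤ 24 * (σ₁ ^ 2 / ε ^ 2) := by
    rw [hW, mul_div_assoc']
    refine div_le_div_of_nonneg_right ?_ (by positivity)
    nlinarith
  have hC : 0 ≤ p.Δ * σ₁ * A / ε ^ 3 := by positivity
  -- `881 = 529 + 351 + 1`, and `24 · 881 + 6 < 25000`.
  calc p.meanQueries ≤ (5 * p.Δ / (3 * η * ε) + 1) * (881 * W) + 6 * (σ₁ ^ 2 / ε ^ 2) := by
        rw [Params.meanQueries]
        gcongr
        linarith
    _ = 881 * (5 * p.Δ / (3 * η * ε) * W) + 881 * W + 6 * (σ₁ ^ 2 / ε ^ 2) := by ring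
    _ ≤ _ := by
        rw [hWΔ]
        have : 0 ≤ σ₁ ^ 2 / ε ^ 2 := by positivity
        linarith

theorem div_cube_mono {Δ L₂ σ₁ σ₂ l ε : ℝ} (hΔ : 0 < Δ) (hL : 0 ≤ L₂) (hσ₁ : 0 < σ₁)
    (hε : 0 < ε) :
    Δ * σ₁ * (σ₂ * l + √(L₂ * (ε / 350))) / (ε / 350) ^ 3 ≤
      350 ^ 3 * (Δ * σ₁ * (σ₂ * l + √(L₂ * ε)) / ε ^ 3) := by
  have h : Δ * σ₁ * (σ₂ * l + √(L₂ * (ε / 350))) / (ε / 350) ^ 3 =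
      350 ^ 3 * (Δ * σ₁ * (σ₂ * l + √(L₂ * (ε / 350))) / ε ^ 3) := by
    field_simp
  rw [h]
  gcongr
  linarith

end CubicRVR

end

theorem theorem2 :
    ∃ C : ℝ, 0 < C ∧
      ∀ (d : ℕ) (Δ L₂ σ₁ σ₂ ε : ℝ) (Z : Type*) [MeasurableSpace Z]
        (F : CubicRVR.Pt d → ℝ) (O : CubicRVR.Oracle d Z)
        (solve : ℕ → CubicRVR.Pt d → CubicRVR.Pt d → CubicRVR.Op d → CubicRVR.Pt d),
        2 ≤ d → 0 < Δ → 0 ≤ L₂ → 0 < σ₂ → 0 < ε → ε < σ₁ →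
        CubicRVR.InFunctionClass Δ L₂ F →
        CubicRVR.InOracleClass F σ₁ σ₂ O →
        -- the algorithm is run with the precision parameter `ε / 350`
        CubicRVR.IsCubicSolver ⟨d, Δ, L₂, σ₁, σ₂, ε / 350⟩ solve →
        -- for every `ε`, counting separately the first gradient batch
        (3 / 4 ≤ CubicRVR.seedLaw ⟨d, Δ, L₂, σ₁, σ₂, ε / 350⟩ O
          {ω | ‖gradient F (CubicRVR.output ⟨d, Δ, L₂, σ₁, σ₂, ε / 350⟩ O solve ω)‖ ≤ ε ∧
            (CubicRVR.totalQueries ⟨d, Δ, L₂, σ₁, σ₂, ε / 350⟩ O solve ω : ℝ) ≤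
              C * (CubicRVR.complexity d Δ L₂ σ₁ σ₂ ε + σ₁ ^ 2 / ε ^ 2)}) ∧
        -- the stated complexity, for all `ε` at which it covers the first gradient batch
        (ε * σ₁ ≤ Δ * (σ₂ * √(Real.log d) + √(L₂ * ε)) →
          3 / 4 ≤ CubicRVR.seedLaw ⟨d, Δ, L₂, σ₁, σ₂, ε / 350⟩ O
            {ω | ‖gradient F (CubicRVR.output ⟨d, Δ, L₂, σ₁, σ₂, ε / 350⟩ O solve ω)‖ ≤ ε ∧
              (CubicRVR.totalQueries ⟨d, Δ, L₂, σ₁, σ₂, ε / 350⟩ O solve ω : ℝ) ≤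
                C * CubicRVR.complexity d Δ L₂ σ₁ σ₂ ε}) := by
  -- `25000` from the mean, `10` from Markov, `350³` from the rescaled precision, and `2` to absorb
  -- `σ₁² / ε²` under (*).
  refine ⟨500000 * 350 ^ 3, by norm_num, ?_⟩
  intro d Δ L₂ σ₁ σ₂ ε Z _ F O solve hd hΔ hL hσ₂ hε hlt hF hO hs
  have hσ₁ : 0 < σ₁ := hε.trans hlt
  set p : CubicRVR.Params := ⟨d, Δ, L₂, σ₁, σ₂, ε / 350⟩ with hpdef
  have hp : p.Admissible := ⟨hd, hΔ, hL, hσ₂, by positivity, by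
    show ε / 350 < σ₁
    linarith⟩
  have hε' : 350 * p.ε = ε := by show 350 * (ε / 350) = ε; ring
  have hmean : 10 * p.meanQueries ≤ 250000 * 350 ^ 3 *
      (CubicRVR.complexity d Δ L₂ σ₁ σ₂ ε + σ₁ ^ 2 / ε ^ 2) := by
    have h1 : p.meanQueries ≤ 25000 *
        (Δ * σ₁ * (σ₂ * √(Real.log d) + √(L₂ * (ε / 350))) / (ε / 350) ^ 3 +
          σ₁ ^ 2 / (ε / 350) ^ 2) := hp.meanQueries_le
    have h2 := CubicRVR.div_cube_mono (σ₂ := σ₂) (l := √(Real.log d)) hΔ hL hσ₁ hε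
    have h3 : σ₁ ^ 2 / (ε / 350) ^ 2 = 350 ^ 2 * (σ₁ ^ 2 / ε ^ 2) := by field_simp
    have h4 : 0 ≤ σ₁ ^ 2 / ε ^ 2 := by positivity
    rw [CubicRVR.complexity_eq hL hε]
    linarith
  have hC : 0 ≤ CubicRVR.complexity d Δ L₂ σ₁ σ₂ ε := by
    rw [CubicRVR.complexity_eq hL hε]
    positivity
  have hprob := fun B hB => CubicRVR.three_fourths_le_seedLaw (B := B) hp hF hO hs hB
  rw [hε'] at hprob
  constructor
  · refine hprob _ (hmean.trans ?_)
    gcongr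
    norm_num
  · intro hstar
    refine hprob _ (hmean.trans ?_)
    have h1 : σ₁ ^ 2 / ε ^ 2 ≤ CubicRVR.complexity d Δ L₂ σ₁ σ₂ ε := by
      rw [CubicRVR.complexity_eq hL hε, div_le_div_iff₀ (by positivity) (by positivity)]
      calc σ₁ ^ 2 * ε ^ 3 = σ₁ * ε ^ 2 * (ε * σ₁) := by ring
        _ ≤ σ₁ * ε ^ 2 * (Δ * (σ₂ * √(Real.log d) + √(L₂ * ε))) := by gcongr
        _ = _ := by ring
    linarith
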